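/- Let $k$ be a commutative ring and let $F$ be a $k$-algebra (concentrated in even parity) that is free of finite rank as a $k$-module, with a finite basis $B$. Let $\operatorname{tr}\colon F\to k$ be a symmetrizing trace, that is, a $k$-linear map such that $\operatorname{tr}(fg)=\operatorname{tr}(gf)$ for all $f,g\in F$ and such that $f\mapsto (g\mapsto \operatorname{tr}(gf))$ is an isomorphism $F\to \operatorname{Hom}_k(F,k)$. Let $\{b^\vee\mid b\in B\}$ be the dual basis, so $\operatorname{tr}(b^\vee c)=\delta_{b,c}$ for $b,c\in B$. Let $n\ge 1$. For $f\in F$ let $f_i=1^{\otimes(i-1)}\otimes f\otimes 1^{\otimes(n-i)}\in F^{\otimes n}$, and for $i\neq j$ let $t_{i,j}=\sum_{b\in B} b_i\,(b^\vee)_j$. The symmetric group $S_n$ acts on $F^{\otimes n}$ by permuting the tensor factors, written $a\mapsto{}^{\pi}a$, and $s_i\in S_n$ is the transposition of $i$ and $i+1$. Let $\mathcal A_n(F)$ be the affinized symmetric algebra: the free product of $k$-algebras $k[x_1,\dots,x_n]\star F^{\otimes n}\star kS_n$ modulo the relations $$a\,x_i=x_i\,a,\qquad \pi\,a={}^{\pi}a\,\pi,\qquad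 s_i x_j=x_j s_i\ (j\ne i,i+1),\qquad s_i x_i=x_{i+1}s_i-t_{i,i+1},$$ for all $a\in F^{\otimes n}$, $\pi\in S_n$ and all admissible $i,j$. Let $Z(F)$ be the center of $F$, let $d\ge 0$, let $c^{(1)},\dots,c^{(d)}\in (Z(F)^{\otimes n})^{S_n}\subseteq F^{\otimes n}$ (the $S_n$-invariant elements of the image of $Z(F)^{\otimes n}$ in $F^{\otimes n}$), and let $\mathcal A_n^{\mathbf C}(F)=\mathcal A_n(F)/J$, where $J$ is the two-sided ideal generated by $\prod_{j=1}^d\bigl(x_1-c^{(j)}\bigr)$. Then the canonical images of the elements $$x_1^{\alpha_1}\cdots x_n^{\alpha_n}\,(b_1\otimes\cdots\otimes b_n)\,\pi,\qquad 0\le \alpha_1,\dots,\alpha_n<d,\quad b_1,\dots,b_n\in B,\quad \pi\in S_n,$$ form a basis of $\mathcal A_n^{\mathbf C}(F)$ as a $k$-module (the family indexed by the tuples $(\alpha,(b_1,\dots,b_n),\pi)$ is linearly independent and spans). -/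

import Mathlib

open scoped TensorProduct

namespace AffSym

universe u v w

section Frobenius

variable {k : Type u} [CommRing k] {F : Type v} [Ring F] [Algebra k F]

/-- The map `F → Hom_k(F, k)`, `f ↦ (g ↦ tr (g f))`, attached to a linear form `tr` on `F`. -/
def toDual (tr : F →ₗ[k] k) : F →ₗ[k] Module.Dual k F where
  toFun f := tr ∘ₗ LinearMap.mulRight k f
  map_add' f g := by ext h; simp [mul_add]
  map_smul' r f := by ext h; simp

/-- `tr` is a symmetrizing trace on the (purely even) algebra `F`: it is a symmetric form, and
it is nondegenerate in the sense that `f ↦ (g ↦ tr (g f))` is an isomorphism from `F` onto its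
`k`-linear dual.  Equivalently, `tr` makes `F` a Frobenius algebra with trivial Nakayama
automorphism. -/
structure IsSymmetrizing (tr : F →ₗ[k] k) : Prop where
  symm : ∀ f g : F, tr (f * g) = tr (g * f)
  bijective : Function.Bijective (toDual tr)

/-- The left dual `(b i)^∨` of the basis element `b i`: the element with
`tr ((b i)^∨ * b j) = δ_{i j}`, see `tr_dualBasis_mul`. -/
noncomputable def dualBasis {tr : F →ₗ[k] k} (htr : IsSymmetrizing tr) {ι : Type w}
    (b : Module.Basis ι k F) (i : ι) : F :=
  (LinearEquiv.ofBijective (toDual tr) htr.bijective).symm (b.coord i)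

theorem tr_dualBasis_mul {tr : F →ₗ[k] k} (htr : IsSymmetrizing tr) {ι : Type w} [DecidableEq ι]
    (b : Module.Basis ι k F) (i j : ι) :
    tr (dualBasis htr b i * b j) = if i = j then 1 else 0 := by
  have h : toDual tr (dualBasis htr b i) = b.coord i :=
    (LinearEquiv.ofBijective (toDual tr) htr.bijective).apply_symm_apply (b.coord i)
  have h2 := LinearMap.congr_fun h (b j)
  rw [htr.symm]
  simpa [toDual, Finsupp.single_apply, eq_comm] using h2

end Frobenius

section Tensor

variable (k : Type u) [CommRing k] (F : Type v) [Ring F] [Algebra k F] (n : ℕ)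

/-- The `n`-fold tensor power `F^{⊗ n}` over `k`, with its componentwise multiplication. -/
abbrev TensorPow : Type (max u v) := ⨂[k] _i : Fin n, F

variable {n}

/-- The left action of a permutation on `F^{⊗ n}` by permuting the tensor factors: the factor in
position `i` is moved to position `π i`. -/
noncomputable def permTensor (π : Equiv.Perm (Fin n)) : TensorPow k F n →ₗ[k] TensorPow k F n :=
  (PiTensorProduct.reindex k (fun _ : Fin n => F) π).toLinearMap

theorem permTensor_tprod (π : Equiv.Perm (Fin n)) (f : Fin n → F) :
    permTensor k F π (PiTensorProduct.tprod k f) =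
      PiTensorProduct.tprod k (fun i => f (π.symm i)) :=
  PiTensorProduct.reindex_tprod π f

variable {F}

/-- `f_i = 1 ⊗ ⋯ ⊗ f ⊗ ⋯ ⊗ 1`, with `f` in position `i`. -/
noncomputable def place (i : Fin n) (f : F) : TensorPow k F n :=
  PiTensorProduct.tprod k (Function.update (fun _ : Fin n => (1 : F)) i f)

variable {k}

/-- The element `t_{i,j} = ∑_{b ∈ B} b_i (b^∨)_j` of `F^{⊗ n}`, for a basis `B` of `F`. -/
noncomputable def tElt {tr : F →ₗ[k] k} (htr : IsSymmetrizing tr) {ι : Type w} [Fintype ι]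
    (b : Module.Basis ι k F) (i j : Fin n) : TensorPow k F n :=
  ∑ l : ι, place k i (b l) * place k j (dualBasis htr b l)

variable (k F) (n)

/-- `Z(F)^{⊗ n}`, as a submodule of `F^{⊗ n}`. -/
noncomputable def centerPow : Submodule k (TensorPow k F n) :=
  LinearMap.range (PiTensorProduct.map
    (fun _ : Fin n => (Subalgebra.center k F).val.toLinearMap))

/-- `(Z(F)^{⊗ n})^{S_n}`, the invariants in `Z(F)^{⊗ n}` for the permutation action. -/
noncomputable def centerPowInvariants : Submodule k (TensorPow k F n) where
  carrier := {c | c ∈ centerPow k F n ∧ ∀ π : Equiv.Perm (Fin n), permTensor k F π c = c}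
  add_mem' := fun ha hb =>
    ⟨add_mem ha.1 hb.1, fun π => by rw [map_add, ha.2 π, hb.2 π]⟩
  zero_mem' := ⟨zero_mem _, fun π => map_zero _⟩
  smul_mem' := fun r _ ha =>
    ⟨Submodule.smul_mem _ r ha.1, fun π => by rw [map_smul, ha.2 π]⟩

end Tensor

section Algebra

/-- Generators of the affinized symmetric algebra: the polynomial generators `x_1, …, x_n`, the
elements of `F^{⊗ n}` and the elements of `S_n`. -/
inductive Gen (k : Type u) [CommRing k] (F : Type v) [Ring F] [Algebra k F] (n : ℕ) :
    Type (max u v)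
  | x (i : Fin n) : Gen k F n
  | ten (a : TensorPow k F n) : Gen k F n
  | perm (π : Equiv.Perm (Fin n)) : Gen k F n

variable {k : Type u} [CommRing k] {F : Type v} [Ring F] [Algebra k F]

/-- Defining relations of the affinized symmetric algebra, imposed on the free `k`-algebra on the
generators.  The first six constructors present the free product
`k[x_1, …, x_n] ⋆ F^{⊗ n} ⋆ k S_n`; the last four are the relations between the three factors.
In `perm_mul_x_of_ne` and `perm_mul_x` one has `j = i + 1`, so that
`Equiv.swap i j` is the simple transposition `s_i`. -/
inductive Rel {tr : F →ₗ[k] k} (htr : IsSymmetrizing tr) {ι : Type w} [Fintype ι]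
    (b : Module.Basis ι k F) (n : ℕ) :
    FreeAlgebra k (Gen k F n) → FreeAlgebra k (Gen k F n) → Prop
  | x_mul_x (i j : Fin n) :
      Rel htr b n (FreeAlgebra.ι k (.x i) * FreeAlgebra.ι k (.x j))
        (FreeAlgebra.ι k (.x j) * FreeAlgebra.ι k (.x i))
  | ten_add (a a' : TensorPow k F n) :
      Rel htr b n (FreeAlgebra.ι k (.ten (a + a')))
        (FreeAlgebra.ι k (.ten a) + FreeAlgebra.ι k (.ten a'))
  | ten_mul (a a' : TensorPow k F n) :
      Rel htr b n (FreeAlgebra.ι k (.ten (a * a')))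
        (FreeAlgebra.ι k (.ten a) * FreeAlgebra.ι k (.ten a'))
  | ten_algebraMap (r : k) :
      Rel htr b n (FreeAlgebra.ι k (.ten (algebraMap k (TensorPow k F n) r)))
        (algebraMap k (FreeAlgebra k (Gen k F n)) r)
  | perm_one :
      Rel htr b n (FreeAlgebra.ι k (.perm 1)) 1
  | perm_mul (π σ : Equiv.Perm (Fin n)) :
      Rel htr b n (FreeAlgebra.ι k (.perm (π * σ)))
        (FreeAlgebra.ι k (.perm π) * FreeAlgebra.ι k (.perm σ))
  | ten_mul_x (a : TensorPow k F n) (i : Fin n) :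
      Rel htr b n (FreeAlgebra.ι k (.ten a) * FreeAlgebra.ι k (.x i))
        (FreeAlgebra.ι k (.x i) * FreeAlgebra.ι k (.ten a))
  | perm_mul_x_of_ne (i j l : Fin n) (hij : (i : ℕ) + 1 = j) (hi : l ≠ i) (hj : l ≠ j) :
      Rel htr b n (FreeAlgebra.ι k (.perm (Equiv.swap i j)) * FreeAlgebra.ι k (.x l))
        (FreeAlgebra.ι k (.x l) * FreeAlgebra.ι k (.perm (Equiv.swap i j)))
  | perm_mul_x (i j : Fin n) (hij : (i : ℕ) + 1 = j) :
      Rel htr b n (FreeAlgebra.ι k (.perm (Equiv.swap i j)) * FreeAlgebra.ι k (.x i))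
        (FreeAlgebra.ι k (.x j) * FreeAlgebra.ι k (.perm (Equiv.swap i j))
          - FreeAlgebra.ι k (.ten (tElt htr b i j)))
  | perm_mul_ten (π : Equiv.Perm (Fin n)) (a : TensorPow k F n) :
      Rel htr b n (FreeAlgebra.ι k (.perm π) * FreeAlgebra.ι k (.ten a))
        (FreeAlgebra.ι k (.ten (permTensor k F π a)) * FreeAlgebra.ι k (.perm π))

variable {tr : F →ₗ[k] k} (htr : IsSymmetrizing tr) {ι : Type w} [Fintype ι]
  (b : Module.Basis ι k F) (n : ℕ)

/-- The affinized symmetric algebra `A_n(F)`, i.e. the affine wreath product algebra of a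
symmetric algebra `F` concentrated in even parity. -/
abbrev AffAlg : Type (max u v) := RingQuot (Rel htr b n)

variable {n}

/-- The generator `x_i` of `A_n(F)`. -/
noncomputable def xGen (i : Fin n) : AffAlg htr b n :=
  RingQuot.mkAlgHom k (Rel htr b n) (FreeAlgebra.ι k (.x i))

/-- The image in `A_n(F)` of an element of `F^{⊗ n}`. -/
noncomputable def ten (a : TensorPow k F n) : AffAlg htr b n :=
  RingQuot.mkAlgHom k (Rel htr b n) (FreeAlgebra.ι k (.ten a))

/-- The image in `A_n(F)` of a permutation. -/
noncomputable def perm (π : Equiv.Perm (Fin n)) : AffAlg htr b n :=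
  RingQuot.mkAlgHom k (Rel htr b n) (FreeAlgebra.ι k (.perm π))

/-- The monomial `x^α = x_1^{α_1} ⋯ x_n^{α_n}` in `A_n(F)`. -/
noncomputable def xPow (α : Fin n → ℕ) : AffAlg htr b n :=
  (List.ofFn fun i => xGen htr b i ^ α i).prod

/-- The element `χ_C = (x_1 - c_1) ⋯ (x_1 - c_d)` of `A_n(F)`. -/
noncomputable def chi [NeZero n] {d : ℕ} (c : Fin d → TensorPow k F n) : AffAlg htr b n :=
  (List.ofFn fun j => xGen htr b 0 - ten htr b (c j)).prod

/-- The two-sided ideal `J_C` of `A_n(F)` generated by `χ_C`. -/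
noncomputable def cycIdeal [NeZero n] {d : ℕ} (c : Fin d → TensorPow k F n) :
    TwoSidedIdeal (AffAlg htr b n) :=
  TwoSidedIdeal.span {chi htr b c}

/-- The cyclotomic quotient `A_n^C(F) = A_n(F) / J_C`, of level `d`. -/
abbrev CycAlg [NeZero n] {d : ℕ} (c : Fin d → TensorPow k F n) : Type (max u v) :=
  (cycIdeal htr b c).ringCon.Quotient

/-- The canonical image in `A_n^C(F)` of the element
`x^α (b_{φ(1)} ⊗ ⋯ ⊗ b_{φ(n)}) π` of `A_n(F)`, where `α_1, …, α_n < d`. -/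
noncomputable def cycElt [NeZero n] {d : ℕ} (c : Fin d → TensorPow k F n)
    (p : (Fin n → Fin d) × (Fin n → ι) × Equiv.Perm (Fin n)) : CycAlg htr b c :=
  (cycIdeal htr b c).ringCon.mk'
    (xPow htr b (fun i => (p.1 i : ℕ)) *
      ten htr b (PiTensorProduct.tprod k fun i => b (p.2.1 i)) *
      perm htr b p.2.2)

end Algebra

end AffSym

namespace AffSym

/-! ### The permutation action and the elements `place` in the tensor power. -/

section TensorFacts

variable {k : Type*} [CommRing k] {F : Type*} [Ring F] [Algebra k F] {n : ℕ}

/-! Independence comes from an explicit module, spanning from a degree filtration.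

Consider functions on pairs (colouring of the positions by natural numbers, permutation) with values
in `F^{⊗ n}`. Tensors act by multiplication and permutations act diagonally. The generator `x_i`
acts at a colouring `f` as multiplication by `c (f i)`, plus the operator lowering the colour at `i`
by one, plus the sum over `l` of `theta i l f` times `τ_{i,l} = t_{i,l} (i l)`. The coefficient
`theta` has two pieces. The bracket comparing positions is a Jucys-Murphy sum, and its failure to be
equivariant produces exactly the term `t_{i,i+1}` of the relation for `s_i x_i`. The bracket
comparing colours is equivariant, and it is what makes the `x_i` commute with the colour terms
present (`braidOp_triple`, `braidOp_pair`, `xOp_commute`). The result is the representation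
`colRep`.

Vectors supported on colours below `d` form a submodule, and `χ_C` kills it: the factors of `χ_C`,
from the last to the first, each lower by one the bound on the colour of the first position
(`prod_xOp_sub_eq_zero`). So the quotient acts there. On the vector with all colours `d - 1`, the
monomial `x^α` has leading term the shift by `α` (`HasLeadingShift`), all exponents below `d` give
legitimate colourings, and the second index records the permutation. A nontrivial relation is
refuted by looking at its terms of top degree.

For spanning, filter by the total degree in the `x_i`. Permutations preserve the filtration and
permute the `x_i` up to degree zero (`perm_mul_xGen_sub_mem`), so `π χ_C` equals `x_{π 0} ^ d π` up
to lower degree. Modulo the ideal, a monomial with some exponent at least `d` thus drops in degree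
(`mkₐ_mem_span_cycElt`). -/

theorem place_eq_singleAlgHom (i : Fin n) (f : F) :
    place k i f = PiTensorProduct.singleAlgHom (R := k) (A := fun _ : Fin n => F) i f := rfl

theorem place_mul (i : Fin n) (f g : F) :
    place k i (f * g) = place k i f * place k i g := by
  simp only [place_eq_singleAlgHom, map_mul]

theorem place_smul (i : Fin n) (r : k) (f : F) :
    place k i (r • f) = r • place k i f := by
  simp only [place_eq_singleAlgHom, map_smul]

theorem place_sum {κ : Type*} (i : Fin n) (s : Finset κ) (f : κ → F) :
    place k i (∑ l ∈ s, f l) = ∑ l ∈ s, place k i (f l) := by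
  simp only [place_eq_singleAlgHom, map_sum]

theorem place_commute {i j : Fin n} (hij : i ≠ j) (f g : F) :
    place k i f * place k j g = place k j g * place k i f := by
  have : Commute (Function.update (fun _ : Fin n => (1 : F)) i f)
      (Function.update (fun _ : Fin n => (1 : F)) j g) := by
    refine Pi.commute_iff.2 fun l => ?_
    by_cases hi : l = i
    · subst hi; simp [Function.update_of_ne hij]
    · simp [Function.update_of_ne hi]
  exact (Commute.tprod (R := k) this).eq

/-- The permutation action on `F^{⊗ n}` is multiplicative. -/
theorem permTensor_mul (π : Equiv.Perm (Fin n)) (a a' : TensorPow k F n) :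
    permTensor k F π (a * a') = permTensor k F π a * permTensor k F π a' := by
  have h : (LinearMap.mul k (TensorPow k F n)).compr₂ (permTensor k F π) =
      (LinearMap.mul k (TensorPow k F n)).compl₁₂ (permTensor k F π) (permTensor k F π) := by
    ext x y
    simp [permTensor_tprod]
    rfl
  exact LinearMap.congr_fun₂ h a a'

theorem permTensor_one_right (π : Equiv.Perm (Fin n)) :
    permTensor k F π (1 : TensorPow k F n) = 1 := by
  rw [PiTensorProduct.one_def, permTensor_tprod]; rfl

theorem permTensor_algebraMap (π : Equiv.Perm (Fin n)) (r : k) :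
    permTensor k F π (algebraMap k (TensorPow k F n) r) = algebraMap k (TensorPow k F n) r := by
  rw [Algebra.algebraMap_eq_smul_one, map_smul, permTensor_one_right]

theorem permTensor_one_left (a : TensorPow k F n) : permTensor k F 1 a = a := by
  have h : permTensor k F (1 : Equiv.Perm (Fin n)) = LinearMap.id := by
    ext x
    simp [permTensor_tprod]
    rfl
  rw [h]; rfl

theorem permTensor_mul_left (π σ : Equiv.Perm (Fin n)) (a : TensorPow k F n) :
    permTensor k F (π * σ) a = permTensor k F π (permTensor k F σ a) := by
  have h : permTensor k F (π * σ) = permTensor k F π ∘ₗ permTensor k F σ := by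
    ext x
    simp [permTensor_tprod]
    rfl
  rw [h]; rfl

theorem permTensor_place (π : Equiv.Perm (Fin n)) (i : Fin n) (f : F) :
    permTensor k F π (place k i f) = place k (π i) f := by
  rw [place, place, permTensor_tprod]
  congr 1
  ext l
  by_cases h : l = π i
  · subst h; simp
  · have h' : π.symm l ≠ i := fun e => h (by simp [← e])
    simp [h, h']

theorem tprod_eq_list_prod_place (f : Fin n → F) :
    PiTensorProduct.tprod k f =
      (List.ofFn fun i => place k i (f i)).prod := by
  have h : ∀ l : List (Fin n), l.Nodup →
      (l.map fun i => place k i (f i)).prod =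
        PiTensorProduct.tprod k (fun i => if i ∈ l then f i else 1) := by
    intro l
    induction l with
    | nil => intro _; simp; rfl
    | cons a l ih =>
      intro hl
      rw [List.nodup_cons] at hl
      rw [List.map_cons, List.prod_cons, ih hl.2, place, PiTensorProduct.tprod_mul_tprod]
      congr 1
      ext i
      by_cases hi : i = a
      · subst hi; simp [hl.1]
      · simp [hi]
  rw [List.ofFn_eq_map, h _ (List.nodup_finRange n)]
  simp

/-- A predicate on `F^{⊗ n}` stable under sums and products that holds on scalars and on the
elements `f_i` holds everywhere. -/
theorem tensorPow_induction {p : TensorPow k F n → Prop}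
    (hplace : ∀ i f, p (place k i f)) (hscal : ∀ r : k, p (algebraMap k _ r))
    (hadd : ∀ a a', p a → p a' → p (a + a')) (hmul : ∀ a a', p a → p a' → p (a * a'))
    (a : TensorPow k F n) : p a := by
  induction a using PiTensorProduct.induction_on with
  | smul_tprod r f =>
    rw [Algebra.smul_def]
    refine hmul _ _ (hscal r) ?_
    rw [tprod_eq_list_prod_place]
    have : ∀ l : List (TensorPow k F n), (∀ x ∈ l, p x) → p l.prod := by
      intro l
      induction l with
      | nil => intro _; simpa using hscal 1
      | cons x l ih =>
        intro h
        rw [List.prod_cons]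
        exact hmul _ _ (h x (by simp)) (ih fun y hy => h y (by simp [hy]))
    refine this _ fun x hx => ?_
    obtain ⟨i, rfl⟩ := (List.mem_ofFn' _ _).1 hx
    exact hplace _ _
  | add x y hx hy => exact hadd _ _ hx hy

/-- Elements of `Z(F)^{⊗ n}` are central in `F^{⊗ n}`. -/
theorem centerPow_commute {z : TensorPow k F n} (hz : z ∈ centerPow k F n)
    (a : TensorPow k F n) : Commute z a := by
  obtain ⟨y, rfl⟩ := hz
  induction y using PiTensorProduct.induction_on with
  | smul_tprod r f =>
    rw [map_smul, PiTensorProduct.map_tprod]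
    refine Commute.smul_left ?_ r
    induction a using PiTensorProduct.induction_on with
    | smul_tprod s g =>
      refine Commute.smul_right ?_ s
      refine Commute.tprod (R := k) (Pi.commute_iff.2 fun l => ?_)
      exact ((Subalgebra.mem_center_iff.1 (f l).2) (g l)).symm
    | add x y hx hy => exact hx.add_right hy
  | add x y hx hy => rw [map_add]; exact hx.add_left hy

end TensorFacts

/-! ### Dual bases and the elements `t_{i,j}`. -/

section Teleporter

variable {k : Type*} [CommRing k] {F : Type*} [Ring F] [Algebra k F] {tr : F →ₗ[k] k}
  (htr : IsSymmetrizing tr) {ι : Type*} [Fintype ι] (b : Module.Basis ι k F) {n : ℕ}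

theorem eq_of_tr_mul_eq {tr : F →ₗ[k] k} (htr : IsSymmetrizing tr) {ι : Type*}
    (b : Module.Basis ι k F) {f g : F} (h : ∀ l, tr (b l * f) = tr (b l * g)) : f = g := by
  apply htr.bijective.1
  refine b.ext fun l => ?_
  simpa [toDual] using h l

/-- By nondegeneracy it suffices to pair both sides with each basis element; symmetry of the trace
then brings in the duality relation. -/
theorem sum_tr_mul_dualBasis (f : F) : ∑ l, tr (f * b l) • dualBasis htr b l = f := by
  classical
  refine eq_of_tr_mul_eq htr b fun m => ?_
  rw [htr.symm, Finset.sum_mul, map_sum, htr.symm (b m)]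
  simp [tr_dualBasis_mul]

theorem sum_tr_dualBasis_mul (f : F) : ∑ l, tr (dualBasis htr b l * f) • b l = f := by
  classical
  conv_rhs => rw [← b.sum_repr f]
  refine Finset.sum_congr rfl fun l _ => ?_
  congr 1
  conv_lhs => rw [← b.sum_repr f, Finset.mul_sum, map_sum]
  simp [tr_dualBasis_mul]

/-- Expanding each `b l` in the dual basis turns `t_{i,j}` into the Gram matrix of the trace form,
which is symmetric. -/
theorem tElt_symm {i j : Fin n} (hij : i ≠ j) : tElt htr b i j = tElt htr b j i := by
  have key : ∀ i j : Fin n, tElt htr b i j = ∑ l, ∑ m, tr (b l * b m) •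
      (place k i (dualBasis htr b m) * place k j (dualBasis htr b l)) := by
    intro i j
    refine Finset.sum_congr rfl fun l _ => ?_
    conv_lhs => rw [← sum_tr_mul_dualBasis htr b (b l)]
    simp [place_sum, place_smul, Finset.sum_mul]
  rw [key i j, key j i, Finset.sum_comm]
  refine Finset.sum_congr rfl fun m _ => Finset.sum_congr rfl fun l _ => ?_
  rw [htr.symm, place_commute hij]

theorem permTensor_tElt (π : Equiv.Perm (Fin n)) (i j : Fin n) :
    permTensor k F π (tElt htr b i j) = tElt htr b (π i) (π j) := by
  simp [tElt, permTensor_mul, permTensor_place]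

/-- Expanding `f * b l` in the basis and `b_m^∨ * f` in the dual basis gives the same coefficients
`tr (b_m^∨ f b_l)`. -/
theorem place_left_mul_tElt (i j : Fin n) (f : F) :
    place k i f * tElt htr b i j = tElt htr b i j * place k j f := by
  have h1 : place k i f * tElt htr b i j = ∑ l, ∑ m, tr (dualBasis htr b m * (f * b l)) •
      (place k i (b m) * place k j (dualBasis htr b l)) := by
    rw [tElt, Finset.mul_sum]
    refine Finset.sum_congr rfl fun l _ => ?_
    rw [← mul_assoc, ← place_mul]
    conv_lhs => rw [← sum_tr_dualBasis_mul htr b (f * b l)]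
    simp [place_sum, place_smul, Finset.sum_mul]
  have h2 : tElt htr b i j * place k j f = ∑ m, ∑ l, tr (dualBasis htr b m * f * b l) •
      (place k i (b m) * place k j (dualBasis htr b l)) := by
    rw [tElt, Finset.sum_mul]
    refine Finset.sum_congr rfl fun m _ => ?_
    rw [mul_assoc, ← place_mul]
    conv_lhs => rw [← sum_tr_mul_dualBasis htr b (dualBasis htr b m * f)]
    simp [place_sum, place_smul, Finset.mul_sum]
  rw [h1, h2, Finset.sum_comm]
  simp only [mul_assoc]

/-- `t_{i,j}` intertwines the identity and the exchange of the factors `i` and `j`. -/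
theorem mul_tElt {i j : Fin n} (hij : i ≠ j) (a : TensorPow k F n) :
    a * tElt htr b i j = tElt htr b i j * permTensor k F (Equiv.swap i j) a := by
  induction a using tensorPow_induction with
  | hplace l f =>
    rw [permTensor_place]
    by_cases hi : l = i
    · subst hi; rw [Equiv.swap_apply_left, place_left_mul_tElt]
    by_cases hj : l = j
    · subst hj
      rw [Equiv.swap_apply_right, tElt_symm htr b hij, place_left_mul_tElt]
    · rw [Equiv.swap_apply_of_ne_of_ne hi hj, tElt, Finset.mul_sum, Finset.sum_mul]
      refine Finset.sum_congr rfl fun m _ => ?_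
      rw [← mul_assoc, place_commute hi, mul_assoc, place_commute hj, mul_assoc]
  | hscal r => rw [permTensor_algebraMap, Algebra.commutes]
  | hadd a a' h h' => rw [add_mul, h, h', map_add, mul_add]
  | hmul a a' h h' => rw [mul_assoc, h', ← mul_assoc, h, mul_assoc, permTensor_mul]

end Teleporter

/-! ### Operators on coloured vectors and their commutation rules. -/

section Operators

variable (k : Type*) [CommRing k] (F : Type*) [Ring F] [Algebra k F] (n : ℕ)

/-- The module on which the affinized symmetric algebra is represented: families of elements of
`F^{⊗ n}` indexed by colourings of the `n` positions and permutations. -/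
abbrev ColMod : Type _ := (Fin n → ℕ) × Equiv.Perm (Fin n) → TensorPow k F n

variable {k F n}

/-- Multiplication by an element of `F^{⊗ n}` depending on the colouring. -/
noncomputable def diagOp (φ : (Fin n → ℕ) → TensorPow k F n) : Module.End k (ColMod k F n) where
  toFun v p := φ p.1 * v p
  map_add' _ _ := by ext p; simp [mul_add]
  map_smul' _ _ := by ext p; simp

variable (k F) in
/-- Multiplication by an integer depending on the colouring. -/
noncomputable def weightOp (ψ : (Fin n → ℕ) → ℤ) : Module.End k (ColMod k F n) :=
  diagOp fun f => (ψ f : TensorPow k F n)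

variable (k F) in
/-- The operator shifting the colour of the position `i`. -/
noncomputable def shiftOp (i : Fin n) : Module.End k (ColMod k F n) where
  toFun v p := v (p.1 + Pi.single i 1, p.2)
  map_add' _ _ := rfl
  map_smul' _ _ := rfl

variable (k F) in
/-- The diagonal action of a permutation. -/
noncomputable def permOp (π : Equiv.Perm (Fin n)) : Module.End k (ColMod k F n) where
  toFun v p := permTensor k F π (v (p.1 ∘ π, π⁻¹ * p.2))
  map_add' _ _ := by ext p; simp
  map_smul' _ _ := by ext p; simp

@[simp] theorem diagOp_apply (φ : (Fin n → ℕ) → TensorPow k F n) (v : ColMod k F n)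
    (p : (Fin n → ℕ) × Equiv.Perm (Fin n)) : diagOp φ v p = φ p.1 * v p := rfl

@[simp] theorem weightOp_apply (ψ : (Fin n → ℕ) → ℤ) (v : ColMod k F n)
    (p : (Fin n → ℕ) × Equiv.Perm (Fin n)) : weightOp k F ψ v p = (ψ p.1 : TensorPow k F n) * v p :=
  rfl

@[simp] theorem shiftOp_apply (i : Fin n) (v : ColMod k F n)
    (p : (Fin n → ℕ) × Equiv.Perm (Fin n)) :
    shiftOp k F i v p = v (p.1 + Pi.single i 1, p.2) := rfl

@[simp] theorem permOp_apply (π : Equiv.Perm (Fin n)) (v : ColMod k F n)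
    (p : (Fin n → ℕ) × Equiv.Perm (Fin n)) :
    permOp k F π v p = permTensor k F π (v (p.1 ∘ π, π⁻¹ * p.2)) := rfl

theorem diagOp_mul (φ ψ : (Fin n → ℕ) → TensorPow k F n) :
    diagOp φ * diagOp ψ = diagOp (fun f => φ f * ψ f) := by
  ext v p; simp [mul_assoc]

theorem diagOp_add (φ ψ : (Fin n → ℕ) → TensorPow k F n) :
    diagOp φ + diagOp ψ = diagOp (fun f => φ f + ψ f) := by
  ext v p; simp [add_mul]

theorem diagOp_sub (φ ψ : (Fin n → ℕ) → TensorPow k F n) :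
    diagOp φ - diagOp ψ = diagOp (fun f => φ f - ψ f) := by
  ext v p; simp [sub_mul]

theorem diagOp_zero : diagOp (fun _ => 0 : (Fin n → ℕ) → TensorPow k F n) = 0 := by
  ext v p; simp

theorem weightOp_mul (φ ψ : (Fin n → ℕ) → ℤ) :
    weightOp k F φ * weightOp k F ψ = weightOp k F (fun f => φ f * ψ f) := by
  ext v p; simp [mul_assoc]

theorem weightOp_add (φ ψ : (Fin n → ℕ) → ℤ) :
    weightOp k F φ + weightOp k F ψ = weightOp k F (fun f => φ f + ψ f) := by
  ext v p; simp [add_mul]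

theorem weightOp_sub (φ ψ : (Fin n → ℕ) → ℤ) :
    weightOp k F φ - weightOp k F ψ = weightOp k F (fun f => φ f - ψ f) := by
  ext v p; simp [sub_mul]

theorem weightOp_zero : weightOp k F (fun _ => 0 : (Fin n → ℕ) → ℤ) = 0 := by
  ext v p; simp

theorem diagOp_mul_weightOp (φ : (Fin n → ℕ) → TensorPow k F n) (ψ : (Fin n → ℕ) → ℤ) :
    diagOp φ * weightOp k F ψ = weightOp k F ψ * diagOp φ := by
  ext v p
  simp only [Module.End.mul_apply, diagOp_apply, weightOp_apply, ← mul_assoc]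
  rw [(Int.cast_commute _ _).eq]

theorem shiftOp_commute (i j : Fin n) : shiftOp k F i * shiftOp k F j =
    shiftOp k F j * shiftOp k F i := by
  ext v p
  simp [add_right_comm]

theorem shiftOp_mul_diagOp (i : Fin n) (φ : (Fin n → ℕ) → TensorPow k F n) :
    shiftOp k F i * diagOp φ = diagOp (fun f => φ (f + Pi.single i 1)) * shiftOp k F i := rfl

theorem shiftOp_mul_weightOp (i : Fin n) (ψ : (Fin n → ℕ) → ℤ) :
    shiftOp k F i * weightOp k F ψ = weightOp k F (fun f => ψ (f + Pi.single i 1)) *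
      shiftOp k F i := rfl

theorem permOp_one : permOp k F (1 : Equiv.Perm (Fin n)) = 1 := by
  ext v p; simp [permTensor_one_left]

theorem permOp_mul (π σ : Equiv.Perm (Fin n)) :
    permOp k F (π * σ) = permOp k F π * permOp k F σ := by
  ext v p
  simp [permTensor_mul_left, Function.comp_assoc, mul_assoc]

theorem permOp_mul_diagOp (π : Equiv.Perm (Fin n)) (φ : (Fin n → ℕ) → TensorPow k F n) :
    permOp k F π * diagOp φ =
      diagOp (fun f => permTensor k F π (φ (f ∘ π))) * permOp k F π := by
  ext v p; simp [permTensor_mul]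

theorem permOp_mul_weightOp (π : Equiv.Perm (Fin n)) (ψ : (Fin n → ℕ) → ℤ) :
    permOp k F π * weightOp k F ψ = weightOp k F (fun f => ψ (f ∘ π)) * permOp k F π := by
  rw [weightOp, permOp_mul_diagOp, weightOp]
  congr 2
  funext f
  simpa using permTensor_algebraMap (F := F) π (ψ (f ∘ π) : k)

theorem permOp_mul_shiftOp (π : Equiv.Perm (Fin n)) (i : Fin n) :
    permOp k F π * shiftOp k F i = shiftOp k F (π i) * permOp k F π := by
  ext v p
  have h : (p.1 + Pi.single (π i) 1) ∘ π = p.1 ∘ π + Pi.single i 1 := by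
    ext l
    simp [Pi.single_apply]
  simp [h]

variable {tr : F →ₗ[k] k} (htr : IsSymmetrizing tr) {ι : Type*} [Fintype ι]
  (b : Module.Basis ι k F)

/-- The operator `t_{i,j} (i j)`. -/
noncomputable def tauOp (i j : Fin n) : Module.End k (ColMod k F n) :=
  diagOp (fun _ => tElt htr b i j) * permOp k F (Equiv.swap i j)

theorem permOp_mul_tauOp (π : Equiv.Perm (Fin n)) (i j : Fin n) :
    permOp k F π * tauOp htr b i j = tauOp htr b (π i) (π j) * permOp k F π := by
  rw [tauOp, tauOp, ← mul_assoc, permOp_mul_diagOp, permTensor_tElt, mul_assoc, mul_assoc,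
    ← permOp_mul, ← permOp_mul, Equiv.mul_swap_eq_swap_mul]

theorem tauOp_symm {i j : Fin n} (hij : i ≠ j) : tauOp htr b i j = tauOp htr b j i := by
  rw [tauOp, tauOp, tElt_symm htr b hij, Equiv.swap_comm]

/-- The exchange of factors made by the transposition is undone by `mul_tElt`, so only the colouring
is permuted. In particular `τ_{i,j}` commutes with all of `F^{⊗ n}`. -/
theorem tauOp_mul_diagOp {i j : Fin n} (hij : i ≠ j) (φ : (Fin n → ℕ) → TensorPow k F n) :
    tauOp htr b i j * diagOp φ = diagOp (fun f => φ (f ∘ Equiv.swap i j)) * tauOp htr b i j := by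
  rw [tauOp, mul_assoc, permOp_mul_diagOp, ← mul_assoc, ← mul_assoc, diagOp_mul, diagOp_mul]
  simp only [mul_tElt htr b hij]

theorem tauOp_mul_weightOp {i j : Fin n} (hij : i ≠ j) (ψ : (Fin n → ℕ) → ℤ) :
    tauOp htr b i j * weightOp k F ψ =
      weightOp k F (fun f => ψ (f ∘ Equiv.swap i j)) * tauOp htr b i j :=
  tauOp_mul_diagOp htr b hij _

/-- Conjugation of `t_{l,m} (l m)` by `t_{i,j} (i j)`. -/
theorem tauOp_mul_tauOp {i j l m : Fin n} (hlm : l ≠ m) :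
    tauOp htr b i j * tauOp htr b l m =
      tauOp htr b (Equiv.swap i j l) (Equiv.swap i j m) * tauOp htr b i j := by
  have h : Equiv.swap i j l ≠ Equiv.swap i j m := by simpa using hlm
  conv_lhs => rw [tauOp, mul_assoc, permOp_mul_tauOp, ← mul_assoc]
  rw [← tauOp_mul_diagOp htr b h (fun _ => tElt htr b i j), mul_assoc]
  rfl

theorem tauOp_mul_shiftOp (i j l : Fin n) :
    tauOp htr b i j * shiftOp k F l = shiftOp k F (Equiv.swap i j l) * tauOp htr b i j := by
  rw [tauOp, mul_assoc, permOp_mul_shiftOp, ← mul_assoc, ← mul_assoc, shiftOp_mul_diagOp]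

/-- The integer `[j < i] - [f i < f j]` attached to a colouring `f`. -/
def theta (i j : Fin n) (f : Fin n → ℕ) : ℤ :=
  (if j < i then 1 else 0) - (if f i < f j then 1 else 0)

theorem theta_self (i : Fin n) (f : Fin n → ℕ) : theta i i f = 0 := by simp [theta]

/-- The summands of the operator by which `x_i` acts that involve permutations. -/
noncomputable def braidOp (i l : Fin n) : Module.End k (ColMod k F n) :=
  weightOp k F (theta i l) * tauOp htr b i l

theorem braidOp_self (i : Fin n) : braidOp htr b i i = 0 := by
  have h : theta i i = fun _ => 0 := funext (theta_self i)
  rw [braidOp, h, weightOp_zero, zero_mul]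

theorem braidOp_mul_braidOp {i j l m : Fin n} (hij : i ≠ j) :
    braidOp htr b i j * braidOp htr b l m =
      weightOp k F (fun f => theta i j f * theta l m (f ∘ Equiv.swap i j)) *
        (tauOp htr b i j * tauOp htr b l m) := by
  rw [braidOp, braidOp, mul_assoc, ← mul_assoc (tauOp htr b i j), tauOp_mul_weightOp htr b hij,
    mul_assoc, ← mul_assoc, weightOp_mul]

theorem braidOp_commute {i j l m : Fin n} (hij : i ≠ j) (hil : i ≠ l) (him : i ≠ m)
    (hjl : j ≠ l) (hjm : j ≠ m) (hlm : l ≠ m) :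
    braidOp htr b i j * braidOp htr b l m = braidOp htr b l m * braidOp htr b i j := by
  rw [braidOp_mul_braidOp htr b hij, braidOp_mul_braidOp htr b hlm, tauOp_mul_tauOp htr b hlm,
    Equiv.swap_apply_of_ne_of_ne hil.symm hjl.symm, Equiv.swap_apply_of_ne_of_ne him.symm hjm.symm]
  congr 2
  funext f
  simp only [theta, Function.comp_apply, Equiv.swap_apply_of_ne_of_ne hil.symm hjl.symm,
    Equiv.swap_apply_of_ne_of_ne him.symm hjm.symm, Equiv.swap_apply_of_ne_of_ne hil him,
    Equiv.swap_apply_of_ne_of_ne hjl hjm]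
  ring

/-- The three commutators that involve exactly the positions `i`, `j`, `l`. Conjugation of the `τ`'s
reduces the six products to two operators, one for each three-cycle, and the integer coefficient of
each vanishes. -/
theorem braidOp_triple {i j l : Fin n} (hij : i ≠ j) (hil : i ≠ l) (hjl : j ≠ l) :
    (braidOp htr b i j * braidOp htr b j l - braidOp htr b j l * braidOp htr b i j) +
      (braidOp htr b i l * braidOp htr b j i - braidOp htr b j i * braidOp htr b i l) +
      (braidOp htr b i l * braidOp htr b j l - braidOp htr b j l * braidOp htr b i l) = 0 := by
  have e1 : tauOp htr b i l * tauOp htr b j i = tauOp htr b i j * tauOp htr b j l := by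
    rw [tauOp_mul_tauOp htr b hjl, Equiv.swap_apply_right,
      Equiv.swap_apply_of_ne_of_ne hil.symm hjl.symm, tauOp_symm htr b hij]
  have e2 : tauOp htr b j l * tauOp htr b i l = tauOp htr b i j * tauOp htr b j l := by
    rw [tauOp_mul_tauOp htr b hil, Equiv.swap_apply_right, Equiv.swap_apply_of_ne_of_ne hij hil]
  have e3 : tauOp htr b j i * tauOp htr b i l = tauOp htr b j l * tauOp htr b i j := by
    rw [tauOp_mul_tauOp htr b hil, Equiv.swap_apply_right,
      Equiv.swap_apply_of_ne_of_ne hjl.symm hil.symm, tauOp_symm htr b hij]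
  have e4 : tauOp htr b i l * tauOp htr b j l = tauOp htr b j l * tauOp htr b i j := by
    rw [tauOp_mul_tauOp htr b hij, Equiv.swap_apply_left, Equiv.swap_apply_of_ne_of_ne hij hil]
  rw [braidOp_mul_braidOp htr b hij, braidOp_mul_braidOp htr b hjl,
    braidOp_mul_braidOp htr b hil, braidOp_mul_braidOp htr b hij.symm,
    braidOp_mul_braidOp htr b hil, braidOp_mul_braidOp htr b hjl, e1, e2, e3, e4]
  generalize tauOp htr b i j * tauOp htr b j l = C
  generalize tauOp htr b j l * tauOp htr b i j = C'
  have collect : ∀ u₁ u₂ u₃ u₄ u₅ u₆ : (Fin n → ℕ) → ℤ, (∀ f, u₁ f + u₃ f - u₆ f = 0) →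
      (∀ f, u₅ f - u₂ f - u₄ f = 0) →
      (weightOp k F u₁ * C - weightOp k F u₂ * C') + (weightOp k F u₃ * C - weightOp k F u₄ * C') +
        (weightOp k F u₅ * C' - weightOp k F u₆ * C) = 0 := by
    intro u₁ u₂ u₃ u₄ u₅ u₆ h h'
    have e : weightOp k F u₁ + weightOp k F u₃ - weightOp k F u₆ = 0 := by
      rw [weightOp_add, weightOp_sub, funext h, weightOp_zero]
    have e' : weightOp k F u₅ - weightOp k F u₂ - weightOp k F u₄ = 0 := by
      rw [weightOp_sub, weightOp_sub, funext h', weightOp_zero]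
    trans (weightOp k F u₁ + weightOp k F u₃ - weightOp k F u₆) * C +
      (weightOp k F u₅ - weightOp k F u₂ - weightOp k F u₄) * C'
    · simp only [add_mul, sub_mul]; abel
    · rw [e, e', zero_mul, zero_mul, add_zero]
  have hij' := Fin.val_ne_of_ne hij
  have hil' := Fin.val_ne_of_ne hil
  have hjl' := Fin.val_ne_of_ne hjl
  -- Each coefficient depends only on the relative order of `i`, `j`, `l` and of their colours, so
  -- finitely many cases remain.
  apply collect <;> intro f <;>
  simp only [theta, Function.comp_apply, Equiv.swap_apply_left, Equiv.swap_apply_right,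
    Equiv.swap_apply_of_ne_of_ne hil.symm hjl.symm, Equiv.swap_apply_of_ne_of_ne hij hil,
    Equiv.swap_apply_of_ne_of_ne hij.symm hjl, Fin.lt_def] <;>
  grind

end Operators

/-- Bookkeeping for the commutators of the summands `braidOp i l` and `braidOp j m`: disjoint pairs
commute, each third index `l` contributes a cancelling triple, and only the term on the pair `i`,
`j` survives. -/
theorem sum_sum_eq_of_distinct {κ M : Type*} [Fintype κ] [DecidableEq κ] [AddCommMonoid M]
    {i j : κ} (hij : i ≠ j) (g : κ → κ → M) (hi : ∀ m, g i m = 0) (hj : ∀ l, g l j = 0)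
    (hd : ∀ l m, l ≠ i → l ≠ j → m ≠ i → m ≠ j → l ≠ m → g l m = 0)
    (ht : ∀ l, l ≠ i → l ≠ j → g j l + g l i + g l l = 0) :
    ∑ l, ∑ m, g l m = g j i := by
  let u : κ → (κ → M) → M := fun l h => if l = i ∨ l = j then 0 else h l
  have h : ∀ l m, g l m = (if l = j then if m = i then g j i else 0 else 0) +
      (if l = j then u m fun m => g j m else 0) + (if m = i then u l fun l => g l i else 0) +
      (if m = l then u l fun l => g l l else 0) := by
    intro l m
    by_cases hli : l = i
    · subst hli; simp [u, hi, hij]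
    by_cases hlj : l = j
    · subst hlj
      by_cases hmi : m = i
      · subst hmi; simp [u, hli, hij]
      by_cases hml : m = l
      · subst hml; simp [u, hmi, hj]
      · simp [u, hmi, hml]
    by_cases hmi : m = i
    · subst hmi; simp [u, hli, hlj, Ne.symm hli]
    by_cases hml : m = l
    · subst hml; simp [u, hli, hlj]
    by_cases hmj : m = j
    · subst hmj; simp [hlj, Ne.symm hlj, hij.symm, hj]
    · simp [hlj, hmi, hml, hd l m hli hlj hmi hmj (Ne.symm hml)]
  have hu : ∑ l, (u l (fun l => g j l) + u l (fun l => g l i) + u l fun l => g l l) = 0 := by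
    refine Finset.sum_eq_zero fun l _ => ?_
    by_cases hl : l = i ∨ l = j
    · simp [u, hl]
    · have := ht l (fun h => hl (.inl h)) fun h => hl (.inr h)
      simpa [u, hl] using this
  rw [Finset.sum_congr rfl fun l _ => Finset.sum_congr rfl fun m _ => h l m]
  simp only [Finset.sum_add_distrib, Finset.sum_ite_irrel, Finset.sum_const_zero,
    Finset.sum_ite_eq', Finset.mem_univ, if_true] at hu ⊢
  rw [add_assoc, add_assoc, ← add_assoc (∑ l, u l _), hu, add_zero]

/-! ### The action of the generators and the defining relations. -/

section Representation

variable {k : Type*} [CommRing k] {F : Type*} [Ring F] [Algebra k F] {n : ℕ}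
  {tr : F →ₗ[k] k} (htr : IsSymmetrizing tr) {ι : Type*} [Fintype ι]
  (b : Module.Basis ι k F) (c : ℕ → TensorPow k F n)

/-- Multiplication by the element `c` attached to the colour of the position `i`. -/
noncomputable def colorOp (i : Fin n) : Module.End k (ColMod k F n) :=
  diagOp fun f => c (f i)

/-- The part of the commutator of `x_i` and `x_j` that lives on the two positions `i`, `j` alone.
Its quadratic, colour and shift contributions vanish separately. -/
theorem braidOp_pair {i j : Fin n} (hij : i ≠ j) :
    ((colorOp c i + shiftOp k F i) * braidOp htr b j i -
        braidOp htr b j i * (colorOp c i + shiftOp k F i)) +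
      (braidOp htr b i j * (colorOp c j + shiftOp k F j) -
        (colorOp c j + shiftOp k F j) * braidOp htr b i j) +
      (braidOp htr b i j * braidOp htr b j i - braidOp htr b j i * braidOp htr b i j) = 0 := by
  have hij' := Fin.val_ne_of_ne hij
  have hquad : braidOp htr b i j * braidOp htr b j i - braidOp htr b j i * braidOp htr b i j
      = 0 := by
    rw [braidOp_mul_braidOp htr b hij, braidOp_mul_braidOp htr b hij.symm,
      tauOp_symm htr b hij, sub_eq_zero]
    congr 2
    funext f
    -- Exactly one of `i < j` and `j < i` holds, so each coefficient is `-A (1 - A)` up to sign,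
    -- with `A` zero or one, and vanishes.
    simp only [theta, Function.comp_apply, Equiv.swap_apply_left, Equiv.swap_apply_right,
      Fin.lt_def]
    grind
  have hcolor : (colorOp c i * braidOp htr b j i - braidOp htr b j i * colorOp c i) +
      (braidOp htr b i j * colorOp c j - colorOp c j * braidOp htr b i j) = 0 := by
    -- For distinct colours the two integers cancel; for equal colours the two colour elements
    -- agree.
    have e : (weightOp k F (theta j i) + weightOp k F (theta i j)) *
        (colorOp c i - colorOp c j) = 0 := by
      rw [weightOp_add, colorOp, colorOp, diagOp_sub, weightOp, diagOp_mul, ← diagOp_zero]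
      congr 1
      funext f
      by_cases h : f i = f j
      · rw [h, sub_self, mul_zero]
      · have : theta j i f + theta i j f = 0 := by
          simp only [theta, Fin.lt_def]; grind
        rw [this, Int.cast_zero, zero_mul]
    have e1 : tauOp htr b i j * colorOp c i = colorOp c j * tauOp htr b i j := by
      rw [colorOp, tauOp_mul_diagOp htr b hij]
      simp [colorOp]
    have e2 : tauOp htr b i j * colorOp c j = colorOp c i * tauOp htr b i j := by
      rw [colorOp, tauOp_mul_diagOp htr b hij]
      simp [colorOp]
    have e3 : ∀ i ψ, colorOp c i * weightOp k F ψ = weightOp k F ψ * colorOp c i :=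
      fun i ψ => diagOp_mul_weightOp _ _
    rw [braidOp, braidOp, ← tauOp_symm htr b hij, ← mul_assoc, ← mul_assoc,
      mul_assoc _ _ (colorOp c i),
      mul_assoc _ _ (colorOp c j), e1, e2, e3, e3]
    trans (weightOp k F (theta j i) + weightOp k F (theta i j)) *
        (colorOp c i - colorOp c j) * tauOp htr b i j
    · simp only [mul_sub, add_mul, sub_mul, ← mul_assoc]; abel
    · rw [e, zero_mul]
  have hshift : (shiftOp k F i * braidOp htr b j i - braidOp htr b j i * shiftOp k F i) +
      (braidOp htr b i j * shiftOp k F j - shiftOp k F j * braidOp htr b i j) = 0 := by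
    -- After raising the colour of `i`, the comparison `f j < f i + 1` is complementary to `f i < f
    -- j`. This fixes the strict inequality in `theta`.
    have e : ∀ i j : Fin n, i ≠ j → weightOp k F (fun f => theta j i (f + Pi.single i 1)) +
        weightOp k F (theta i j) = 0 := by
      intro i j hij
      have hij' := Fin.val_ne_of_ne hij
      rw [weightOp_add, ← weightOp_zero]
      congr 1
      funext f
      simp only [theta, Pi.add_apply, Pi.single_eq_same, Pi.single_eq_of_ne hij.symm, Fin.lt_def]
      grind
    have e1 : tauOp htr b i j * shiftOp k F i = shiftOp k F j * tauOp htr b i j := by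
      rw [tauOp_mul_shiftOp, Equiv.swap_apply_left]
    have e2 : tauOp htr b i j * shiftOp k F j = shiftOp k F i * tauOp htr b i j := by
      rw [tauOp_mul_shiftOp, Equiv.swap_apply_right]
    rw [braidOp, braidOp, ← tauOp_symm htr b hij, ← mul_assoc, ← mul_assoc,
      mul_assoc _ _ (shiftOp k F i), mul_assoc _ _ (shiftOp k F j), e1, e2,
      shiftOp_mul_weightOp, shiftOp_mul_weightOp]
    trans (weightOp k F (fun f => theta j i (f + Pi.single i 1)) + weightOp k F (theta i j)) *
        shiftOp k F i * tauOp htr b i j -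
        (weightOp k F (fun f => theta i j (f + Pi.single j 1)) + weightOp k F (theta j i)) *
        shiftOp k F j * tauOp htr b i j
    · simp only [add_mul, ← mul_assoc]; abel
    · rw [e i j hij, e j i hij.symm]; simp
  rw [hquad, add_zero]
  trans ((colorOp c i * braidOp htr b j i - braidOp htr b j i * colorOp c i) +
      (braidOp htr b i j * colorOp c j - colorOp c j * braidOp htr b i j)) +
    ((shiftOp k F i * braidOp htr b j i - braidOp htr b j i * shiftOp k F i) +
      (braidOp htr b i j * shiftOp k F j - shiftOp k F j * braidOp htr b i j))
  · simp only [mul_add, add_mul]; abel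
  · rw [hcolor, hshift, add_zero]

/-- The operator by which the generator `x_i` acts. -/
noncomputable def xOp (i : Fin n) : Module.End k (ColMod k F n) :=
  colorOp c i + shiftOp k F i + ∑ l, braidOp htr b i l

theorem braidOp_mul_base_of_ne {i j l : Fin n} (hil : i ≠ l) (hjl : j ≠ l) :
    braidOp htr b i j * (colorOp c l + shiftOp k F l) =
      (colorOp c l + shiftOp k F l) * braidOp htr b i j := by
  by_cases hij : i = j
  · subst hij; simp [braidOp_self]
  have e1 : tauOp htr b i j * colorOp c l = colorOp c l * tauOp htr b i j := by
    rw [colorOp, tauOp_mul_diagOp htr b hij]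
    simp [Equiv.swap_apply_of_ne_of_ne hil.symm hjl.symm]
  have e2 : tauOp htr b i j * shiftOp k F l = shiftOp k F l * tauOp htr b i j := by
    rw [tauOp_mul_shiftOp, Equiv.swap_apply_of_ne_of_ne hil.symm hjl.symm]
  have e3 : shiftOp k F l * weightOp k F (theta i j) =
      weightOp k F (theta i j) * shiftOp k F l := by
    rw [shiftOp_mul_weightOp]
    congr 2
    funext f
    simp [theta, Pi.single_eq_of_ne hil, Pi.single_eq_of_ne hjl]
  rw [braidOp, mul_assoc, mul_add, e1, e2, add_mul, ← mul_assoc (colorOp c l),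
    ← mul_assoc (shiftOp k F l), e3, colorOp, diagOp_mul_weightOp, mul_add, mul_assoc, mul_assoc]

/-- All elements of the family `c` are `S_n`-invariant elements of `Z(F)^{⊗ n}`. -/
def IsCentralFamily (c : ℕ → TensorPow k F n) : Prop :=
  ∀ m, c m ∈ centerPowInvariants k F n

variable {c}

theorem diagOp_mul_colorOp (hc : IsCentralFamily c) (i : Fin n)
    (φ : (Fin n → ℕ) → TensorPow k F n) :
    diagOp φ * colorOp c i = colorOp c i * diagOp φ := by
  rw [colorOp, diagOp_mul, diagOp_mul]
  congr 1
  funext f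
  exact (centerPow_commute (hc (f i)).1 _).symm.eq

/-- The commutator splits according to the positions involved: mixed terms survive only on the pair
`i`, `j`, triples cancel, and `braidOp_pair` disposes of the rest. Centrality of the `c m` enters in
the colour terms. -/
theorem xOp_commute (hc : IsCentralFamily c) (i j : Fin n) :
    xOp htr b c i * xOp htr b c j = xOp htr b c j * xOp htr b c i := by
  rcases eq_or_ne i j with rfl | hij
  · rfl
  have hbase : (colorOp c i + shiftOp k F i) * (colorOp c j + shiftOp k F j) =
      (colorOp c j + shiftOp k F j) * (colorOp c i + shiftOp k F i) := by
    have e : ∀ i j : Fin n, i ≠ j → shiftOp k F i * colorOp c j = colorOp c j * shiftOp k F i := by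
      intro i j hij
      rw [colorOp, shiftOp_mul_diagOp]
      simp [Pi.single_eq_of_ne hij.symm]
    rw [add_mul, mul_add, mul_add, add_mul, mul_add, mul_add, e i j hij, e j i hij.symm,
      shiftOp_commute i j, colorOp, diagOp_mul_colorOp hc, ← colorOp]
    abel
  have h1 : ∑ m, ((colorOp c i + shiftOp k F i) * braidOp htr b j m -
        braidOp htr b j m * (colorOp c i + shiftOp k F i)) =
      (colorOp c i + shiftOp k F i) * braidOp htr b j i -
        braidOp htr b j i * (colorOp c i + shiftOp k F i) := by
    refine Finset.sum_eq_single_of_mem _ (Finset.mem_univ _) fun m _ hm => ?_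
    rw [braidOp_mul_base_of_ne htr b c hij.symm hm, sub_self]
  have h2 : ∑ l, (braidOp htr b i l * (colorOp c j + shiftOp k F j) -
        (colorOp c j + shiftOp k F j) * braidOp htr b i l) =
      braidOp htr b i j * (colorOp c j + shiftOp k F j) -
        (colorOp c j + shiftOp k F j) * braidOp htr b i j := by
    refine Finset.sum_eq_single_of_mem _ (Finset.mem_univ _) fun l _ hl => ?_
    rw [braidOp_mul_base_of_ne htr b c hij hl, sub_self]
  have h3 : ∑ l, ∑ m, (braidOp htr b i l * braidOp htr b j m -
        braidOp htr b j m * braidOp htr b i l) =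
      braidOp htr b i j * braidOp htr b j i - braidOp htr b j i * braidOp htr b i j := by
    refine sum_sum_eq_of_distinct hij _ ?_ ?_ ?_ ?_
    · simp [braidOp_self]
    · simp [braidOp_self]
    · intro l m hli hlj hmi hmj hlm
      rw [braidOp_commute htr b hli.symm hij hmi.symm hlj hlm hmj.symm, sub_self]
    · intro l hli hlj
      exact braidOp_triple htr b hij hli.symm hlj.symm
  rw [← sub_eq_zero, ← braidOp_pair htr b c hij, ← h1, ← h2, ← h3]
  simp only [Finset.sum_sub_distrib, ← Finset.mul_sum, ← Finset.sum_mul, xOp, add_mul (_ + _),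
    mul_add _ (_ + _), hbase]
  abel

/-- Invariance of the `c m` makes the colour part equivariant, as are the shifts and the colour
comparison in `theta`. The correction comes only from the comparison of positions and counts
inversions of `π` involving `i`. -/
theorem permOp_mul_xOp (hc : IsCentralFamily c) (π : Equiv.Perm (Fin n)) (i : Fin n) :
    permOp k F π * xOp htr b c i = (xOp htr b c (π i) +
      ∑ l, weightOp k F (fun _ => (if π.symm l < i then 1 else 0) - (if l < π i then 1 else 0)) *
        tauOp htr b (π i) l) * permOp k F π := by
  have h1 : permOp k F π * colorOp c i = colorOp c (π i) * permOp k F π := by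
    rw [colorOp, permOp_mul_diagOp, colorOp]
    congr 2
    funext f
    exact (hc _).2 π
  have h2 : ∀ l, permOp k F π * braidOp htr b i (π.symm l) =
      (braidOp htr b (π i) l +
        weightOp k F (fun _ => (if π.symm l < i then 1 else 0) - (if l < π i then 1 else 0)) *
        tauOp htr b (π i) l) * permOp k F π := by
    intro l
    rw [braidOp, ← mul_assoc, permOp_mul_weightOp, mul_assoc, permOp_mul_tauOp, ← mul_assoc,
      Equiv.apply_symm_apply]
    congr 1
    rw [braidOp, ← add_mul, weightOp_add]
    congr 2
    funext f
    simp only [theta, Function.comp_apply, Equiv.apply_symm_apply]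
    ring
  rw [xOp, mul_add, mul_add, h1, permOp_mul_shiftOp, xOp, add_assoc (_ + _),
    ← Finset.sum_add_distrib, add_mul, add_mul, Finset.sum_mul, ← Equiv.sum_comp π.symm,
    Finset.mul_sum]
  simp only [h2]

/-- The action of the generators. -/
noncomputable def genOp (c : ℕ → TensorPow k F n) : Gen k F n → Module.End k (ColMod k F n)
  | .x i => xOp htr b c i
  | .ten a => diagOp fun _ => a
  | .perm π => permOp k F π

theorem diagOp_mul_xOp (hc : IsCentralFamily c) (a : TensorPow k F n) (i : Fin n) :
    diagOp (fun _ => a) * xOp htr b c i = xOp htr b c i * diagOp fun _ => a := by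
  rw [xOp, mul_add, mul_add, add_mul, add_mul, diagOp_mul_colorOp hc, shiftOp_mul_diagOp,
    Finset.mul_sum, Finset.sum_mul]
  congr 1
  refine Finset.sum_congr rfl fun l _ => ?_
  rcases eq_or_ne i l with rfl | hil
  · simp [braidOp_self]
  · rw [braidOp, mul_assoc, tauOp_mul_diagOp htr b hil, ← mul_assoc, diagOp_mul_weightOp,
      mul_assoc]

theorem permOp_swap_mul_xOp_of_ne (hc : IsCentralFamily c) {i j l : Fin n}
    (hij : (i : ℕ) + 1 = j) (hi : l ≠ i) (hj : l ≠ j) :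
    permOp k F (Equiv.swap i j) * xOp htr b c l =
      xOp htr b c l * permOp k F (Equiv.swap i j) := by
  rw [permOp_mul_xOp htr b hc, Equiv.swap_apply_of_ne_of_ne hi hj, Finset.sum_eq_zero, add_zero]
  intro m _
  convert zero_mul _
  rw [← weightOp_zero]
  congr 1
  funext _
  rw [Equiv.symm_swap, Equiv.swap_apply_def]
  have hi' := Fin.val_ne_of_ne hi
  have hj' := Fin.val_ne_of_ne hj
  simp only [Fin.lt_def]
  grind

/-- A simple transposition has a single inversion, so one summand of the correction remains; its
transposition cancels against `s_i`, leaving `-t_{i,j}`. -/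
theorem permOp_swap_mul_xOp (hc : IsCentralFamily c) {i j : Fin n} (hij : (i : ℕ) + 1 = j) :
    permOp k F (Equiv.swap i j) * xOp htr b c i =
      xOp htr b c j * permOp k F (Equiv.swap i j) - diagOp fun _ => tElt htr b i j := by
  have hne : i ≠ j := by rintro rfl; omega
  rw [permOp_mul_xOp htr b hc, Equiv.swap_apply_left, Finset.sum_eq_single i, add_mul,
    sub_eq_add_neg (_ * _)]
  · congr 1
    have h1 : ¬ j < i := by simp only [Fin.lt_def]; omega
    have h2 : i < j := by simp only [Fin.lt_def]; omega
    rw [Equiv.symm_swap, Equiv.swap_apply_left, ← tauOp_symm htr b hne, tauOp, mul_assoc,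
      mul_assoc, ← permOp_mul, Equiv.swap_mul_self, permOp_one, mul_one]
    ext v p
    simp [h1, h2]
  · intro l _ hl
    convert zero_mul _
    rw [← weightOp_zero]
    congr 1
    funext _
    rw [Equiv.symm_swap, Equiv.swap_apply_def]
    have hl' := Fin.val_ne_of_ne hl
    simp only [Fin.lt_def]
    grind
  · simp

/-- The representation of the affinized symmetric algebra on the colouring module. -/
noncomputable def colRep (hc : IsCentralFamily c) :
    AffAlg htr b n →ₐ[k] Module.End k (ColMod k F n) :=
  RingQuot.liftAlgHom k ⟨FreeAlgebra.lift k (genOp htr b c), by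
    intro x y h
    induction h with
    | x_mul_x i j => simpa [genOp] using xOp_commute htr b hc i j
    | ten_add a a' => simpa [genOp] using (diagOp_add _ _).symm
    | ten_mul a a' => simpa [genOp] using (diagOp_mul _ _).symm
    | ten_algebraMap r =>
      simp only [FreeAlgebra.lift_ι_apply, AlgHom.commutes, genOp]
      ext v p
      simp [Algebra.algebraMap_eq_smul_one]
    | perm_one => simpa [genOp] using permOp_one
    | perm_mul π σ => simpa [genOp] using permOp_mul π σ
    | ten_mul_x a i => simpa [genOp] using diagOp_mul_xOp htr b hc a i
    | perm_mul_x_of_ne i j l hij hi hj =>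
      simpa [genOp] using permOp_swap_mul_xOp_of_ne htr b hc hij hi hj
    | perm_mul_x i j hij => simpa [genOp] using permOp_swap_mul_xOp htr b hc hij
    | perm_mul_ten π a => simpa [genOp] using permOp_mul_diagOp π fun _ => a⟩

theorem colRep_xGen (hc : IsCentralFamily c) (i : Fin n) :
    colRep htr b hc (xGen htr b i) = xOp htr b c i := by
  simp [colRep, xGen, genOp]

theorem colRep_ten (hc : IsCentralFamily c) (a : TensorPow k F n) :
    colRep htr b hc (ten htr b a) = diagOp fun _ => a := by
  simp [colRep, ten, genOp]

theorem colRep_perm (hc : IsCentralFamily c) (π : Equiv.Perm (Fin n)) :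
    colRep htr b hc (perm htr b π) = permOp k F π := by
  simp [colRep, perm, genOp]

end Representation

/-! ### Induction on elements of the affinized symmetric algebra. -/

section Induction

variable {k : Type*} [CommRing k] {F : Type*} [Ring F] [Algebra k F] {n : ℕ}
  {tr : F →ₗ[k] k} {htr : IsSymmetrizing tr} {ι : Type*} [Fintype ι]
  {b : Module.Basis ι k F}

theorem affAlg_induction {p : AffAlg htr b n → Prop} (hx : ∀ i, p (xGen htr b i))
    (hten : ∀ a, p (ten htr b a)) (hperm : ∀ π, p (perm htr b π))
    (hadd : ∀ y z, p y → p z → p (y + z)) (hmul : ∀ y z, p y → p z → p (y * z))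
    (y : AffAlg htr b n) : p y := by
  obtain ⟨y, rfl⟩ := RingQuot.mkAlgHom_surjective k (Rel htr b n) y
  induction y using FreeAlgebra.induction with
  | grade0 r =>
    -- Scalars are images of scalar tensors, so they need no case of their own.
    rw [← RingQuot.mkAlgHom_rel k (Rel.ten_algebraMap r)]
    exact hten _
  | grade1 g =>
    cases g with
    | x i => exact hx i
    | ten a => exact hten a
    | perm π => exact hperm π
  | mul y z hy hz => rw [map_mul]; exact hmul _ _ hy hz
  | add y z hy hz => rw [map_add]; exact hadd _ _ hy hz

end Induction

/-! ### The cyclotomic quotient acts on bounded colourings; linear independence. -/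

section Independence

variable {k : Type*} [CommRing k] {F : Type*} [Ring F] [Algebra k F] {n : ℕ}
  {tr : F →ₗ[k] k} (htr : IsSymmetrizing tr) {ι : Type*} [Fintype ι]
  (b : Module.Basis ι k F) (c : ℕ → TensorPow k F n)

theorem xOp_apply (i : Fin n) (v : ColMod k F n) (p : (Fin n → ℕ) × Equiv.Perm (Fin n)) :
    xOp htr b c i v p = c (p.1 i) * v p + v (p.1 + Pi.single i 1, p.2) +
      ∑ l, (theta i l p.1 : TensorPow k F n) * (tElt htr b i l *
        permTensor k F (Equiv.swap i l)
          (v (p.1 ∘ Equiv.swap i l, (Equiv.swap i l)⁻¹ * p.2))) := by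
  simp [xOp, colorOp, braidOp, tauOp, LinearMap.sum_apply, Finset.sum_apply]

/-- `v` is supported on the colourings with all colours less than `d`. -/
def IsBounded (d : ℕ) (v : ColMod k F n) : Prop :=
  ∀ p, (∃ i, d ≤ p.1 i) → v p = 0

variable {c}

/-- Permuting positions preserves the largest colour of a colouring, and the shift evaluates `v` at
a colouring with larger colours. -/
theorem colRep_isBounded (hc : IsCentralFamily c) {d : ℕ} (y : AffAlg htr b n) :
    ∀ v : ColMod k F n, IsBounded d v → IsBounded d (colRep htr b hc y v) := by
  have hP : ∀ (π : Equiv.Perm (Fin n)) (v : ColMod k F n) (hv : IsBounded d v)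
      (p : (Fin n → ℕ) × Equiv.Perm (Fin n)) (_ : ∃ i, d ≤ p.1 i),
      v (p.1 ∘ π, π⁻¹ * p.2) = 0 := by
    rintro π v hv p ⟨i, hi⟩
    exact hv _ ⟨π.symm i, by simpa using hi⟩
  induction y using affAlg_induction with
  | hx i =>
    intro v hv p hp
    rw [colRep_xGen, xOp_apply, hv p hp, hv, Finset.sum_eq_zero]
    · simp
    · intro l _
      rw [hP _ v hv p hp]; simp
    · obtain ⟨j, hj⟩ := hp
      exact ⟨j, hj.trans (by simp)⟩
  | hten a => intro v hv p hp; rw [colRep_ten, diagOp_apply, hv p hp, mul_zero]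
  | hperm π => intro v hv p hp; rw [colRep_perm, permOp_apply, hP _ v hv p hp, map_zero]
  | hadd y z hy hz =>
    intro v hv p hp
    rw [map_add, LinearMap.add_apply, Pi.add_apply, hy v hv p hp, hz v hv p hp, add_zero]
  | hmul y z hy hz => intro v hv; rw [map_mul]; exact hy _ (hz v hv)

/-- If colours at position `0` are at most `e`, the factor with `c e` removes the colour `e`: there
the two multiplications agree and the shift sees only zero. A transposition term enters only if `f 0
< f l`, since no position precedes `0`, and it then moves a colour above `e` to position `0`. -/
theorem prod_xOp_sub_eq_zero [NeZero n] (c : ℕ → TensorPow k F n) (e : ℕ) (v : ColMod k F n)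
    (hv : ∀ p, e ≤ p.1 0 → v p = 0) :
    (List.ofFn fun j : Fin e => xOp htr b c 0 - diagOp fun _ => c j).prod v = 0 := by
  induction e generalizing v with
  | zero => ext p; simpa using hv p (Nat.zero_le _)
  | succ e ih =>
    -- The last factor acts first, so it is the one to split off.
    rw [List.ofFn_succ', List.concat_eq_append, List.prod_append, List.prod_singleton,
      Module.End.mul_apply]
    refine ih _ fun p hp => ?_
    rw [LinearMap.sub_apply, Pi.sub_apply, xOp_apply, diagOp_apply, 
      hv (p.1 + Pi.single 0 1, p.2) (by simpa using hp), Finset.sum_eq_zero, add_zero, add_zero,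
      Fin.val_last, sub_eq_zero]
    · rcases hp.eq_or_lt with h | h
      · rw [h]
      · rw [hv p h, mul_zero, mul_zero]
    · intro l _
      by_cases h : p.1 0 < p.1 l
      · rw [hv]
        · simp
        · simpa using Nat.succ_le_of_lt (hp.trans_lt h)
      · have h0 : ¬ l < 0 := by simp
        simp [theta, h, h0]

/-- The elements of `A_n(F)` acting as zero on the vectors supported on the colourings with colours
less than `d`. -/
noncomputable def boundedAnnihilator (hc : IsCentralFamily c) (d : ℕ) :
    TwoSidedIdeal (AffAlg htr b n) :=
  TwoSidedIdeal.mk' {y | ∀ v, IsBounded d v → colRep htr b hc y v = 0}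
    (by intro v _; simp)
    (by intro y z hy hz v hv; simp [hy v hv, hz v hv])
    (by intro y hy v hv; simp [hy v hv])
    (by intro y z hz v hv; simp [hz v hv])
    (by intro y z hy v hv; simpa using hy _ (colRep_isBounded htr b hc z v hv))

theorem chi_mem_boundedAnnihilator [NeZero n] (hc : IsCentralFamily c) (d : ℕ) :
    chi htr b (fun j : Fin d => c j) ∈ boundedAnnihilator htr b hc d := by
  rw [boundedAnnihilator, TwoSidedIdeal.mem_mk']
  intro v hv
  have e : (colRep htr b hc ∘ fun j : Fin d => xGen htr b 0 - ten htr b (c j)) =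
      fun j : Fin d => xOp htr b c 0 - diagOp fun _ => c j := by
    ext1 j
    rw [Function.comp_apply, map_sub, colRep_xGen, colRep_ten]
  rw [chi, map_list_prod, List.map_ofFn, e]
  exact prod_xOp_sub_eq_zero htr b c d v fun p hp => hv p ⟨0, hp⟩

theorem cycIdeal_le_boundedAnnihilator [NeZero n] (hc : IsCentralFamily c) (d : ℕ) :
    cycIdeal htr b (fun j : Fin d => c j) ≤ boundedAnnihilator htr b hc d := by
  rw [cycIdeal, TwoSidedIdeal.span_le, Set.singleton_subset_iff]
  exact chi_mem_boundedAnnihilator htr b hc d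

/-- `g` is the shift of the colourings by `α` up to operators changing the total colour by less
than `∑ i, α i`. -/
def HasLeadingShift (g : Module.End k (ColMod k F n)) (α : Fin n → ℕ) : Prop :=
  ∀ (m : ℕ) (v : ColMod k F n), (∀ p, ∑ i, p.1 i < m → v p = 0) → ∀ p,
    (∑ i, p.1 i + ∑ i, α i < m → g v p = 0) ∧
    (∑ i, p.1 i + ∑ i, α i = m → g v p = v (p.1 + α, p.2))

theorem HasLeadingShift.one : HasLeadingShift (1 : Module.End k (ColMod k F n)) 0 := by
  intro m v hv p
  simpa using hv p

theorem HasLeadingShift.mul {g h : Module.End k (ColMod k F n)} {α β : Fin n → ℕ}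
    (hg : HasLeadingShift g α) (hh : HasLeadingShift h β) : HasLeadingShift (g * h) (α + β) := by
  intro m v hv p
  simp only [Pi.add_apply, Finset.sum_add_distrib, Module.End.mul_apply]
  by_cases hm : ∑ i, β i ≤ m
  · have := hg (m - ∑ i, β i) (h v) (fun q hq => (hh m v hv q).1 (by omega)) p
    refine ⟨fun hp => this.1 (by omega), fun hp => ?_⟩
    rw [this.2 (by omega), (hh m v hv _).2 (by simp [Finset.sum_add_distrib]; omega)]
    simp only [add_assoc]
  · exact ⟨fun _ => by omega, fun _ => by omega⟩

/-- Only the shift changes the total colour; all other terms evaluate `v` at colourings of the same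
total. -/
theorem HasLeadingShift.xOp (c : ℕ → TensorPow k F n) (i : Fin n) :
    HasLeadingShift (xOp htr b c i) (Pi.single i 1) := by
  intro m v hv p
  have hs : ∑ j, (Pi.single i 1 : Fin n → ℕ) j = 1 := by simp
  have key : ∑ j, p.1 j < m → AffSym.xOp htr b c i v p = v (p.1 + Pi.single i 1, p.2) := by
    intro hp
    rw [xOp_apply, hv p hp, Finset.sum_eq_zero]
    · simp
    · intro l _
      rw [hv]
      · simp
      · simpa [Equiv.sum_comp (Equiv.swap i l) p.1] using hp
  rw [hs]
  refine ⟨fun hp => ?_, fun hp => key (by omega)⟩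
  rw [key (by omega), hv]
  simpa [Finset.sum_add_distrib] using hp

theorem HasLeadingShift.pow {g : Module.End k (ColMod k F n)} {α : Fin n → ℕ}
    (hg : HasLeadingShift g α) (e : ℕ) : HasLeadingShift (g ^ e) (e • α) := by
  induction e with
  | zero => simpa using HasLeadingShift.one
  | succ e ih => rw [pow_succ, succ_nsmul]; exact ih.mul hg

theorem HasLeadingShift.list_prod {κ : Type*} (l : List κ) {g : κ → Module.End k (ColMod k F n)}
    {α : κ → Fin n → ℕ} (hg : ∀ i, HasLeadingShift (g i) (α i)) :
    HasLeadingShift (l.map g).prod (l.map α).sum := by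
  induction l with
  | nil => simpa using HasLeadingShift.one
  | cons i l ih => simpa using (hg i).mul ih

theorem HasLeadingShift.xPow (hc : IsCentralFamily c) (α : Fin n → ℕ) :
    HasLeadingShift (colRep htr b hc (xPow htr b α)) α := by
  have h := HasLeadingShift.list_prod (List.finRange n) fun i =>
    (HasLeadingShift.xOp htr b c i).pow (α i)
  convert h using 1
  · rw [AffSym.xPow, List.ofFn_eq_map, map_list_prod, List.map_map]
    congr 2
    ext1 i
    simp [colRep_xGen]
  · rw [← List.ofFn_eq_map, List.sum_ofFn]
    ext j
    simp [Finset.sum_apply, Pi.single_apply]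

/-- The vector concentrated at the colouring with all colours `e`, at the identity. -/
noncomputable def topVec (e : ℕ) : ColMod k F n :=
  Pi.single (fun _ => e, 1) 1

theorem colRep_ten_mul_perm_topVec (hc : IsCentralFamily c) (e : ℕ) (a : TensorPow k F n)
    (π : Equiv.Perm (Fin n)) :
    colRep htr b hc (ten htr b a * perm htr b π) (topVec e) = Pi.single (fun _ => e, π) a := by
  ext p
  rw [map_mul, colRep_ten, colRep_perm, Module.End.mul_apply, diagOp_apply, permOp_apply, topVec]
  by_cases h : p = (fun _ => e, π)
  · subst h
    have : ((fun _ => e) ∘ π, π⁻¹ * π) = ((fun _ => e, 1) : (Fin n → ℕ) × Equiv.Perm (Fin n)) := by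
      simp; rfl
    rw [Pi.single_eq_same, this, Pi.single_eq_same, permTensor_one_right, mul_one]
  · rw [Pi.single_eq_of_ne h, Pi.single_eq_of_ne, map_zero, mul_zero]
    intro h'
    apply h
    rw [Prod.ext_iff] at h' ⊢
    refine ⟨?_, (inv_mul_eq_one.1 h'.2).symm⟩
    ext i
    simpa using congrFun h'.1 (π.symm i)

theorem isBounded_topVec [NeZero n] {d : ℕ} (hd : 0 < d) :
    IsBounded d (topVec (d - 1) : ColMod k F n) := by
  rintro p ⟨i, hi⟩
  refine Pi.single_eq_of_ne ?_ _
  rintro rfl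
  simp only at hi
  omega

theorem linearIndependent_cycElt_aux [NeZero n] (hc : IsCentralFamily c) (d : ℕ) :
    LinearIndependent k (cycElt htr b (fun j : Fin d => c j)) := by
  classical
  rw [Fintype.linearIndependent_iff]
  intro g hg
  by_contra! hne
  -- Choose a term of maximal degree among those with nonzero coefficient.
  obtain ⟨p₀, hp₀, hmax⟩ := Finset.exists_max_image
    (Finset.univ.filter fun p => g p ≠ 0) (fun p => ∑ i, (p.1 i : ℕ)) (by
      obtain ⟨p, hp⟩ := hne
      exact ⟨p, by simpa using hp⟩)
  rw [Finset.mem_filter] at hp₀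
  have hd : 0 < d := (p₀.1 0).pos
  obtain ⟨α₀, φ₀, π₀⟩ := p₀
  let y : (Fin n → Fin d) × (Fin n → ι) × Equiv.Perm (Fin n) → AffAlg htr b n := fun p =>
    xPow htr b (fun i => (p.1 i : ℕ)) *
      ten htr b (PiTensorProduct.tprod k fun i => b (p.2.1 i)) * perm htr b p.2.2
  have hmem : ∑ p, g p • y p ∈ cycIdeal htr b (fun j : Fin d => c j) := by
    refine (RingCon.eq (cycIdeal htr b fun j : Fin d => c j).ringCon).1 ?_
    change (cycIdeal htr b fun j : Fin d => c j).ringCon.mkₐ k (∑ p, g p • y p) = 0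
    rw [map_sum, ← hg]
    exact Finset.sum_congr rfl fun p _ => map_smul _ _ _
  have hact := cycIdeal_le_boundedAnnihilator htr b hc d hmem
  rw [boundedAnnihilator, TwoSidedIdeal.mem_mk'] at hact
  -- At this colouring the total colour falls short of `n * (d - 1)` by the maximal degree, so lower
  -- terms vanish and terms of equal degree contribute only if their exponent and permutation are
  -- those of `p₀`.
  have hval := congrFun (hact _ (isBounded_topVec hd)) (fun i => d - 1 - (α₀ i : ℕ), π₀)
  have hterm : ∀ p, g p • colRep htr b hc (y p) (topVec (d - 1))
      (fun i => d - 1 - (α₀ i : ℕ), π₀) =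
      if p.1 = α₀ ∧ p.2.2 = π₀ then
        g p • (PiTensorProduct.tprod k fun i => b (p.2.1 i)) else 0 := by
    intro p
    by_cases hgp : g p = 0
    · simp [hgp]
    have hle := hmax p (by simpa using hgp)
    have hsum : ∑ i, (d - 1 - (α₀ i : ℕ)) + ∑ i, (α₀ i : ℕ) = n * (d - 1) := by
      rw [← Finset.sum_add_distrib, Finset.sum_congr rfl fun i _ =>
        Nat.sub_add_cancel (Nat.le_sub_one_of_lt (α₀ i).2)]
      simp
    have hlead := HasLeadingShift.xPow htr b hc (fun i => (p.1 i : ℕ)) (n * (d - 1))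
      (Pi.single (fun _ => d - 1, p.2.2) (PiTensorProduct.tprod k fun i => b (p.2.1 i)))
      (by
        intro q hq
        refine Pi.single_eq_of_ne ?_ _
        rintro rfl
        simp at hq) (fun i => d - 1 - (α₀ i : ℕ), π₀)
    simp only [y, mul_assoc]
    rw [map_mul, Module.End.mul_apply, colRep_ten_mul_perm_topVec]
    simp only at hlead hle
    rcases hle.lt_or_eq with hlt | heq
    · rw [hlead.1 (by omega), if_neg, smul_zero]
      rintro ⟨h, -⟩
      rw [h] at hlt
      exact lt_irrefl _ hlt
    · rw [hlead.2 (by omega), Pi.single_apply]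
      have : ((((fun i => d - 1 - (α₀ i : ℕ)) + fun i => (p.1 i : ℕ)), π₀) =
          ((fun _ => d - 1, p.2.2) : (Fin n → ℕ) × Equiv.Perm (Fin n))) ↔
          (p.1 = α₀ ∧ p.2.2 = π₀) := by
        rw [Prod.ext_iff, eq_comm (a := p.2.2)]
        refine and_congr_left fun _ => ?_
        simp only [funext_iff, Fin.ext_iff, Pi.add_apply]
        refine forall_congr' fun i => ?_
        have := (α₀ i).2
        have := (p.1 i).2
        omega
      simp only [this]
      split_ifs <;> simp
  simp only [map_sum, map_smul, LinearMap.sum_apply, LinearMap.smul_apply, Finset.sum_apply,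
    Pi.smul_apply, hterm, Pi.zero_apply] at hval
  simp only [Fintype.sum_prod_type, ite_and, Finset.sum_ite_irrel, Finset.sum_ite_eq',
    Finset.sum_const_zero, Finset.mem_univ, if_true] at hval
  have hli := (Basis.piTensorProduct fun _ : Fin n => b).linearIndependent
  rw [Fintype.linearIndependent_iff] at hli
  refine hp₀.2 (hli (fun φ => g (α₀, φ, π₀)) ?_ φ₀)
  simpa [Basis.piTensorProduct_apply] using hval

theorem linearIndependent_cycElt [NeZero n] {d : ℕ} (c : Fin d → TensorPow k F n)
    (hc : ∀ j, c j ∈ centerPowInvariants k F n) :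
    LinearIndependent k (cycElt htr b c) := by
  -- Colours range over all natural numbers; zero is a harmless central invariant value for those
  -- from `d` on.
  let c' : ℕ → TensorPow k F n := fun m => if h : m < d then c ⟨m, h⟩ else 0
  have hc' : IsCentralFamily c' := by
    intro m
    by_cases h : m < d
    · simpa [c', h] using hc _
    · simp [c', h]
  have h : c = fun j : Fin d => c' j := by
    ext j
    simp [c']
  rw [h]
  exact linearIndependent_cycElt_aux htr b hc' d

end Independence

/-! ### The degree filtration; spanning. -/

section Spanning

variable {k : Type*} [CommRing k] {F : Type*} [Ring F] [Algebra k F] {n : ℕ}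
  {tr : F →ₗ[k] k} (htr : IsSymmetrizing tr) {ι : Type*} [Fintype ι]
  (b : Module.Basis ι k F)

theorem xGen_commute (i j : Fin n) : Commute (xGen htr b i) (xGen htr b j) := by
  rw [commute_iff_eq]
  simpa [xGen] using RingQuot.mkAlgHom_rel k (Rel.x_mul_x (htr := htr) (b := b) i j)

/-- The canonical homomorphism from `F^{⊗ n}` to `A_n(F)`. -/
noncomputable def tenAlgHom : TensorPow k F n →ₐ[k] AffAlg htr b n where
  toFun := ten htr b
  map_one' := by
    simpa [ten] using RingQuot.mkAlgHom_rel k (Rel.ten_algebraMap (htr := htr) (b := b) (n := n) 1)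
  map_zero' := by
    simpa [ten] using RingQuot.mkAlgHom_rel k (Rel.ten_algebraMap (htr := htr) (b := b) (n := n) 0)
  map_mul' a a' := by
    simpa [ten] using RingQuot.mkAlgHom_rel k (Rel.ten_mul (htr := htr) (b := b) a a')
  map_add' a a' := by
    simpa [ten] using RingQuot.mkAlgHom_rel k (Rel.ten_add (htr := htr) (b := b) a a')
  commutes' r := by
    simpa [ten] using RingQuot.mkAlgHom_rel k (Rel.ten_algebraMap (htr := htr) (b := b) (n := n) r)

theorem tenAlgHom_apply (a : TensorPow k F n) : tenAlgHom htr b a = ten htr b a := rfl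

theorem perm_one : perm htr b (1 : Equiv.Perm (Fin n)) = 1 := by
  simpa [perm] using RingQuot.mkAlgHom_rel k (Rel.perm_one (htr := htr) (b := b) (n := n))

theorem perm_mul (π σ : Equiv.Perm (Fin n)) :
    perm htr b (π * σ) = perm htr b π * perm htr b σ := by
  simpa [perm] using RingQuot.mkAlgHom_rel k (Rel.perm_mul (htr := htr) (b := b) π σ)

theorem ten_mul_xGen (a : TensorPow k F n) (i : Fin n) :
    Commute (ten htr b a) (xGen htr b i) := by
  rw [commute_iff_eq]
  simpa [ten, xGen] using RingQuot.mkAlgHom_rel k (Rel.ten_mul_x (htr := htr) (b := b) a i)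

theorem perm_mul_ten (π : Equiv.Perm (Fin n)) (a : TensorPow k F n) :
    perm htr b π * ten htr b a = ten htr b (permTensor k F π a) * perm htr b π := by
  simpa [ten, perm] using RingQuot.mkAlgHom_rel k (Rel.perm_mul_ten (htr := htr) (b := b) π a)

theorem perm_swap_mul_xGen_of_ne {i j l : Fin n} (hij : (i : ℕ) + 1 = j) (hi : l ≠ i)
    (hj : l ≠ j) : perm htr b (Equiv.swap i j) * xGen htr b l =
      xGen htr b l * perm htr b (Equiv.swap i j) := by
  simpa [xGen, perm] using
    RingQuot.mkAlgHom_rel k (Rel.perm_mul_x_of_ne (htr := htr) (b := b) i j l hij hi hj)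

theorem perm_swap_mul_xGen {i j : Fin n} (hij : (i : ℕ) + 1 = j) :
    perm htr b (Equiv.swap i j) * xGen htr b i =
      xGen htr b j * perm htr b (Equiv.swap i j) - ten htr b (tElt htr b i j) := by
  simpa [xGen, perm, ten] using
    RingQuot.mkAlgHom_rel k (Rel.perm_mul_x (htr := htr) (b := b) i j hij)

theorem xPow_zero : xPow htr b (fun _ : Fin n => 0) = 1 := by
  simp [xPow]

theorem xPow_add_single (α : Fin n → ℕ) (i : Fin n) :
    xPow htr b (α + Pi.single i 1) = xGen htr b i * xPow htr b α := by
  have h0 : ∀ l : List (Fin n), i ∉ l →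
      (l.map fun j => xGen htr b j ^ (α + Pi.single i 1 : Fin n → ℕ) j) =
        l.map fun j => xGen htr b j ^ α j := by
    intro l hl
    refine List.map_congr_left fun j hj => ?_
    have : j ≠ i := fun h => hl (h ▸ hj)
    simp [Pi.single_eq_of_ne this]
  have h1 : ∀ l : List (Fin n), l.Nodup → i ∈ l →
      (l.map fun j => xGen htr b j ^ (α + Pi.single i 1 : Fin n → ℕ) j).prod =
        xGen htr b i * (l.map fun j => xGen htr b j ^ α j).prod := by
    intro l
    induction l with
    | nil => intro _ h; simp at h
    | cons j l ih =>
      intro hl hi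
      rw [List.nodup_cons] at hl
      rw [List.map_cons, List.prod_cons, List.map_cons, List.prod_cons]
      by_cases hj : j = i
      · subst hj
        rw [h0 l hl.1, Pi.add_apply, Pi.single_eq_same, pow_succ', mul_assoc]
      · have hil : i ∈ l := by
          rcases List.mem_cons.1 hi with h | h
          · exact absurd h.symm hj
          · exact h
        rw [ih hl.2 hil, Pi.add_apply, Pi.single_eq_of_ne hj, add_zero, ← mul_assoc, ← mul_assoc,
          ((xGen_commute htr b i j).pow_right _).eq]
  rw [xPow, xPow, List.ofFn_eq_map, List.ofFn_eq_map]
  exact h1 _ (List.nodup_finRange n) (List.mem_finRange i)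

theorem xPow_add_single_nsmul (α : Fin n → ℕ) (i : Fin n) (e : ℕ) :
    xPow htr b (α + Pi.single i e) = xGen htr b i ^ e * xPow htr b α := by
  induction e with
  | zero => simp
  | succ e ih => rw [Pi.single_add, ← add_assoc, xPow_add_single, ih, pow_succ', mul_assoc]

theorem ten_mul_xPow (a : TensorPow k F n) (α : Fin n → ℕ) :
    Commute (ten htr b a) (xPow htr b α) := by
  refine Commute.list_prod_right _ _ fun x hx => ?_
  obtain ⟨i, rfl⟩ := (List.mem_ofFn' _ _).1 hx
  exact (ten_mul_xGen htr b a i).pow_right _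

/-- The `k`-span in `A_n(F)` of the elements `x^α a π` with `∑ i, α i < m`. -/
noncomputable def degreeFil (m : ℕ) : Submodule k (AffAlg htr b n) :=
  Submodule.span k {y | ∃ (α : Fin n → ℕ) (a : TensorPow k F n) (π : Equiv.Perm (Fin n)),
    ∑ i, α i < m ∧ y = xPow htr b α * ten htr b a * perm htr b π}

variable {htr b}

theorem mem_degreeFil {m : ℕ} {α : Fin n → ℕ} (a : TensorPow k F n) (π : Equiv.Perm (Fin n))
    (h : ∑ i, α i < m) : xPow htr b α * ten htr b a * perm htr b π ∈ degreeFil htr b m :=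
  Submodule.subset_span ⟨α, a, π, h, rfl⟩

theorem degreeFil_induction {m : ℕ} {V : Type*} [AddCommGroup V] [Module k V]
    (φ : AffAlg htr b n →ₗ[k] V) (S : Submodule k V)
    (h : ∀ (α : Fin n → ℕ) (a : TensorPow k F n) (π : Equiv.Perm (Fin n)), ∑ i, α i < m →
      φ (xPow htr b α * ten htr b a * perm htr b π) ∈ S)
    {y : AffAlg htr b n} (hy : y ∈ degreeFil htr b m) : φ y ∈ S := by
  have : degreeFil htr b m ≤ S.comap φ := by
    refine Submodule.span_le.2 ?_
    rintro _ ⟨α, a, π, hα, rfl⟩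
    exact h α a π hα
  exact this hy

theorem degreeFil_mono {m m' : ℕ} (h : m ≤ m') : degreeFil htr b (n := n) m ≤ degreeFil htr b m' :=
  Submodule.span_mono fun _ ⟨α, a, π, hα, e⟩ => ⟨α, a, π, hα.trans_le h, e⟩

theorem ten_mul_mem_degreeFil (a : TensorPow k F n) {m : ℕ} {y : AffAlg htr b n}
    (hy : y ∈ degreeFil htr b m) : ten htr b a * y ∈ degreeFil htr b m := by
  refine degreeFil_induction (LinearMap.mulLeft k (ten htr b a)) _ (fun α a' π hα => ?_) hy
  rw [LinearMap.mulLeft_apply, ← mul_assoc, ← mul_assoc, (ten_mul_xPow htr b a α).eq, mul_assoc _ _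
    (ten htr b a'), ← tenAlgHom_apply, ← tenAlgHom_apply, ← map_mul]
  exact mem_degreeFil _ _ hα

theorem mul_perm_mem_degreeFil (σ : Equiv.Perm (Fin n)) {m : ℕ} {y : AffAlg htr b n}
    (hy : y ∈ degreeFil htr b m) : y * perm htr b σ ∈ degreeFil htr b m := by
  refine degreeFil_induction (LinearMap.mulRight k (perm htr b σ)) _ (fun α a π hα => ?_) hy
  rw [LinearMap.mulRight_apply, mul_assoc, ← perm_mul]
  exact mem_degreeFil _ _ hα

theorem xGen_mul_mem_degreeFil (i : Fin n) {m : ℕ} {y : AffAlg htr b n}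
    (hy : y ∈ degreeFil htr b m) : xGen htr b i * y ∈ degreeFil htr b (m + 1) := by
  refine degreeFil_induction (LinearMap.mulLeft k (xGen htr b i)) _ (fun α a π hα => ?_) hy
  rw [LinearMap.mulLeft_apply, ← mul_assoc, ← mul_assoc, ← xPow_add_single]
  exact mem_degreeFil _ _ (by simpa [Finset.sum_add_distrib] using hα)

theorem xPow_mul_mem_degreeFil (α : Fin n → ℕ) {m : ℕ} {y : AffAlg htr b n}
    (hy : y ∈ degreeFil htr b m) : xPow htr b α * y ∈ degreeFil htr b (∑ i, α i + m) := by
  have hpow : ∀ (i : Fin n) (e m : ℕ) (y : AffAlg htr b n), y ∈ degreeFil htr b m →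
      xGen htr b i ^ e * y ∈ degreeFil htr b (e + m) := by
    intro i e
    induction e with
    | zero => intro m y hy; simpa using hy
    | succ e ih =>
      intro m y hy
      rw [pow_succ', mul_assoc, add_right_comm]
      exact xGen_mul_mem_degreeFil i (ih m y hy)
  have hlist : ∀ l : List (Fin n), (l.map fun i => xGen htr b i ^ α i).prod * y ∈
      degreeFil htr b ((l.map α).sum + m) := by
    intro l
    induction l with
    | nil => simpa using hy
    | cons i l ih =>
      rw [List.map_cons, List.map_cons, List.prod_cons, List.sum_cons, mul_assoc, add_assoc]
      exact hpow i _ _ _ ih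
  rw [xPow, List.ofFn_eq_map, ← List.sum_ofFn, List.ofFn_eq_map]
  exact hlist _

theorem mem_degreeFil_one (a : TensorPow k F n) (π : Equiv.Perm (Fin n)) :
    ten htr b a * perm htr b π ∈ degreeFil htr b 1 := by
  simpa [xPow_zero] using mem_degreeFil (htr := htr) (b := b) (α := fun _ => 0) (m := 1) a π
    (by simp)

theorem degreeFil_one_induction {V : Type*} [AddCommGroup V] [Module k V]
    (φ : AffAlg htr b n →ₗ[k] V) (S : Submodule k V)
    (h : ∀ (a : TensorPow k F n) (π : Equiv.Perm (Fin n)), φ (ten htr b a * perm htr b π) ∈ S)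
    {y : AffAlg htr b n} (hy : y ∈ degreeFil htr b 1) : φ y ∈ S := by
  refine degreeFil_induction φ S (fun α a π hα => ?_) hy
  have : α = fun _ => 0 := by
    funext i
    exact (Finset.sum_eq_zero_iff.1 (Nat.lt_one_iff.1 hα)) i (Finset.mem_univ i)
  rw [this, xPow_zero, one_mul]
  exact h a π

theorem ten_mem_degreeFil_one (a : TensorPow k F n) : ten htr b a ∈ degreeFil htr b 1 := by
  simpa [perm_one] using mem_degreeFil_one (htr := htr) (b := b) a 1

theorem perm_mem_degreeFil_one (π : Equiv.Perm (Fin n)) : perm htr b π ∈ degreeFil htr b 1 := by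
  have h := mem_degreeFil_one (htr := htr) (b := b) 1 π
  rwa [← tenAlgHom_apply, map_one, one_mul] at h

theorem xGen_mem_degreeFil (i : Fin n) : xGen htr b i ∈ degreeFil htr b 2 := by
  simpa [perm_one] using xGen_mul_mem_degreeFil i (perm_mem_degreeFil_one (htr := htr) (b := b) 1)

theorem perm_mul_mem_degreeFil_one (π : Equiv.Perm (Fin n)) {y : AffAlg htr b n}
    (hy : y ∈ degreeFil htr b 1) : perm htr b π * y ∈ degreeFil htr b 1 := by
  refine degreeFil_one_induction (LinearMap.mulLeft k (perm htr b π)) _ (fun a σ => ?_) hy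
  rw [LinearMap.mulLeft_apply, ← mul_assoc, perm_mul_ten, mul_assoc, ← perm_mul]
  exact mem_degreeFil_one _ _

theorem closure_adjacent_swaps (n : ℕ) :
    Submonoid.closure {π : Equiv.Perm (Fin n) | ∃ i j : Fin n, (i : ℕ) + 1 = j ∧
      π = Equiv.swap i j} = ⊤ := by
  cases n with
  | zero => exact Subsingleton.elim _ _
  | succ n =>
    rw [eq_top_iff, ← Equiv.Perm.mclosure_swap_castSucc_succ]
    refine Submonoid.closure_mono ?_
    rintro _ ⟨i, rfl⟩
    exact ⟨i.castSucc, i.succ, by simp, rfl⟩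

/-- Permutations permute the `x_i` up to elements of degree zero. -/
theorem perm_mul_xGen_sub_mem (π : Equiv.Perm (Fin n)) (j : Fin n) :
    perm htr b π * xGen htr b j - xGen htr b (π j) * perm htr b π ∈ degreeFil htr b 1 := by
  have hπ : π ∈ Submonoid.closure {π : Equiv.Perm (Fin n) | ∃ i j : Fin n, (i : ℕ) + 1 = j ∧
      π = Equiv.swap i j} := by rw [closure_adjacent_swaps]; trivial
  induction hπ using Submonoid.closure_induction generalizing j with
  | mem π h =>
    obtain ⟨i, l, hil, rfl⟩ := h
    have hne : i ≠ l := by rintro rfl; omega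
    by_cases hi : j = i
    · subst hi
      rw [Equiv.swap_apply_left, perm_swap_mul_xGen htr b hil, sub_sub_cancel_left]
      exact neg_mem (ten_mem_degreeFil_one _)
    by_cases hl : j = l
    · subst hl
      -- Conjugating the relation for `s_i x_i` by `s_i` yields the one for `s_i x_{i+1}`, which is
      -- not among the defining relations.
      have h := congrArg (fun y => perm htr b (Equiv.swap i j) * y * perm htr b (Equiv.swap i j))
        (perm_swap_mul_xGen htr b hil)
      have hs : perm htr b (Equiv.swap i j) * perm htr b (Equiv.swap i j) = 1 := by
        rw [← perm_mul, Equiv.swap_mul_self, perm_one]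
      have h' : perm htr b (Equiv.swap i j) * xGen htr b j -
          xGen htr b (Equiv.swap i j j) * perm htr b (Equiv.swap i j) =
          perm htr b (Equiv.swap i j) * ten htr b (tElt htr b i j) *
            perm htr b (Equiv.swap i j) := by
        rw [Equiv.swap_apply_right]
        simp only [mul_sub, sub_mul] at h
        rw [← mul_assoc, hs, one_mul, ← mul_assoc, mul_assoc _ (perm htr b (Equiv.swap i j))
          (perm htr b (Equiv.swap i j)), hs, mul_one] at h
        rw [h, sub_sub_cancel]
      rw [h']
      exact mul_perm_mem_degreeFil _ (perm_mul_mem_degreeFil_one _ (ten_mem_degreeFil_one _))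
    · rw [Equiv.swap_apply_of_ne_of_ne hi hl, perm_swap_mul_xGen_of_ne htr b hil hi hl, sub_self]
      exact zero_mem _
  | one => simp [perm_one]
  | mul π σ _ _ hπ hσ =>
    have h : perm htr b (π * σ) * xGen htr b j - xGen htr b ((π * σ) j) * perm htr b (π * σ) =
        perm htr b π * (perm htr b σ * xGen htr b j - xGen htr b (σ j) * perm htr b σ) +
        (perm htr b π * xGen htr b (σ j) - xGen htr b (π (σ j)) * perm htr b π) *
          perm htr b σ := by
      rw [perm_mul, Equiv.Perm.mul_apply]
      simp only [mul_sub, sub_mul, mul_assoc]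
      abel
    rw [h]
    exact add_mem (perm_mul_mem_degreeFil_one _ (hσ j)) (mul_perm_mem_degreeFil _ (hπ _))

/-- Moving `π` past one `x_j` costs an error of degree zero. The induction on degree must cover all
permutations at once, since the error involves others than `π`. -/
theorem perm_mul_mem_degreeFil (π : Equiv.Perm (Fin n)) {m : ℕ} {y : AffAlg htr b n}
    (hy : y ∈ degreeFil htr b m) : perm htr b π * y ∈ degreeFil htr b m := by
  have key : ∀ (N : ℕ) (α : Fin n → ℕ), ∑ i, α i = N → ∀ (π : Equiv.Perm (Fin n))
      (a : TensorPow k F n) (σ : Equiv.Perm (Fin n)),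
      perm htr b π * (xPow htr b α * ten htr b a * perm htr b σ) ∈ degreeFil htr b (N + 1) := by
    intro N
    induction N with
    | zero =>
      intro α hα π a σ
      exact perm_mul_mem_degreeFil_one _ (mem_degreeFil _ _ (by omega))
    | succ N ih =>
      intro α hα π a σ
      obtain ⟨j, -, hj⟩ := Finset.exists_ne_zero_of_sum_ne_zero (hα.trans_ne N.succ_ne_zero)
      obtain ⟨β, rfl⟩ : ∃ β : Fin n → ℕ, α = β + Pi.single j 1 :=
        ⟨α - Pi.single j 1, by
          ext i
          by_cases h : i = j
          · subst h; simp; omega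
          · simp [Pi.single_eq_of_ne h]⟩
      have hβ : ∑ i, β i = N := by simpa [Finset.sum_add_distrib] using hα
      set w := xPow htr b β * ten htr b a * perm htr b σ with hw
      have e : perm htr b π * (xPow htr b (β + Pi.single j 1) * ten htr b a * perm htr b σ) =
          xGen htr b (π j) * (perm htr b π * w) +
            (perm htr b π * xGen htr b j - xGen htr b (π j) * perm htr b π) * w := by
        rw [xPow_add_single, hw]
        simp only [sub_mul, mul_assoc]
        abel
      rw [e]
      refine add_mem (xGen_mul_mem_degreeFil _ (ih β hβ π a σ)) (degreeFil_mono (Nat.le_succ _) ?_)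
      refine degreeFil_one_induction (LinearMap.mulRight k w) _ (fun a' π' => ?_)
        (perm_mul_xGen_sub_mem π j)
      rw [LinearMap.mulRight_apply, mul_assoc]
      exact ten_mul_mem_degreeFil _ (ih β hβ π' a σ)
  refine degreeFil_induction (LinearMap.mulLeft k (perm htr b π)) _ (fun α a σ hα => ?_) hy
  exact degreeFil_mono hα (key _ α rfl π a σ)

/-- Level `m` means degree strictly below `m`; hence the shift by one in the second factor. -/
theorem mul_mem_degreeFil {m m' : ℕ} {y z : AffAlg htr b n} (hy : y ∈ degreeFil htr b m)
    (hz : z ∈ degreeFil htr b (m' + 1)) : y * z ∈ degreeFil htr b (m + m') := by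
  refine degreeFil_induction (LinearMap.mulRight k z) _ (fun α a σ hα => ?_) hy
  rw [LinearMap.mulRight_apply, mul_assoc, mul_assoc]
  exact degreeFil_mono (by omega) (xPow_mul_mem_degreeFil α
    (ten_mul_mem_degreeFil a (perm_mul_mem_degreeFil σ hz)))

theorem exists_mem_degreeFil (y : AffAlg htr b n) : ∃ m, y ∈ degreeFil htr b m := by
  induction y using affAlg_induction with
  | hx i => exact ⟨2, xGen_mem_degreeFil i⟩
  | hten a => exact ⟨1, ten_mem_degreeFil_one a⟩
  | hperm π => exact ⟨1, perm_mem_degreeFil_one π⟩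
  | hadd y z hy hz =>
    obtain ⟨m, hm⟩ := hy
    obtain ⟨m', hm'⟩ := hz
    exact ⟨max m m', add_mem (degreeFil_mono (le_max_left _ _) hm)
      (degreeFil_mono (le_max_right _ _) hm')⟩
  | hmul y z hy hz =>
    obtain ⟨m, hm⟩ := hy
    obtain ⟨m', hm'⟩ := hz
    exact ⟨m + m', mul_mem_degreeFil hm (degreeFil_mono (Nat.le_succ _) hm')⟩

variable [NeZero n]

theorem chi_mem_degreeFil {d : ℕ} (c : Fin d → TensorPow k F n) :
    chi htr b c ∈ degreeFil htr b (d + 1) := by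
  induction d with
  | zero => simpa [chi, perm_one] using perm_mem_degreeFil_one (htr := htr) (b := b) 1
  | succ d ih =>
    rw [chi, List.ofFn_succ, List.prod_cons]
    have h1 : xGen htr b 0 - ten htr b (c 0) ∈ degreeFil htr b 2 :=
      sub_mem (xGen_mem_degreeFil _) (degreeFil_mono one_le_two (ten_mem_degreeFil_one _))
    exact degreeFil_mono (by omega) (mul_mem_degreeFil h1 (ih fun j => c j.succ))

/-- The leading term of a translate of `χ_C`. -/
theorem perm_mul_chi_sub_mem {d : ℕ} (c : Fin d → TensorPow k F n) (π : Equiv.Perm (Fin n)) :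
    perm htr b π * chi htr b c - xGen htr b (π 0) ^ d * perm htr b π ∈ degreeFil htr b d := by
  induction d with
  | zero => simp [chi]
  | succ d ih =>
    have e : chi htr b c = (xGen htr b 0 - ten htr b (c 0)) * chi htr b fun j => c j.succ := by
      rw [chi, List.ofFn_succ, List.prod_cons]
      rfl
    have e' : perm htr b π * chi htr b c - xGen htr b (π 0) ^ (d + 1) * perm htr b π =
        xGen htr b (π 0) * (perm htr b π * chi htr b (fun j => c j.succ) -
          xGen htr b (π 0) ^ d * perm htr b π) +
        ((perm htr b π * xGen htr b 0 - xGen htr b (π 0) * perm htr b π) -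
          perm htr b π * ten htr b (c 0)) * chi htr b fun j => c j.succ := by
      rw [e, pow_succ']
      simp only [sub_mul, mul_sub, mul_assoc]
      abel
    rw [e']
    refine add_mem (xGen_mul_mem_degreeFil _ (ih _)) ?_
    refine degreeFil_mono (by omega) (mul_mem_degreeFil (m := 1) ?_ (chi_mem_degreeFil _))
    exact sub_mem (perm_mul_xGen_sub_mem π 0)
      (perm_mul_mem_degreeFil_one _ (ten_mem_degreeFil_one _))

theorem mkₐ_chi {d : ℕ} (c : Fin d → TensorPow k F n) :
    (cycIdeal htr b c).ringCon.mkₐ k (chi htr b c) = 0 :=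
  (RingCon.eq (cycIdeal htr b c).ringCon).2
    (TwoSidedIdeal.subset_span (s := {chi htr b c}) rfl)

/-- Reduction on degree: a monomial with all exponents below `d` expands in the basis tensors, and
any other is congruent to an element of lower filtration level. -/
theorem mkₐ_mem_span_cycElt {d : ℕ} (c : Fin d → TensorPow k F n) (m : ℕ) {y : AffAlg htr b n}
    (hy : y ∈ degreeFil htr b m) :
    (cycIdeal htr b c).ringCon.mkₐ k y ∈ Submodule.span k (Set.range (cycElt htr b c)) := by
  induction m generalizing y with
  | zero =>
    exact degreeFil_induction ((cycIdeal htr b c).ringCon.mkₐ k).toLinearMap _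
      (fun α a π hα => absurd hα (Nat.not_lt_zero _)) hy
  | succ m ih =>
    refine degreeFil_induction ((cycIdeal htr b c).ringCon.mkₐ k).toLinearMap _
      (fun α a σ hα => ?_) hy
    rw [AlgHom.toLinearMap_apply]
    by_cases hd : ∀ i, α i < d
    · rw [← (Basis.piTensorProduct fun _ : Fin n => b).sum_repr a, ← tenAlgHom_apply, map_sum,
        Finset.mul_sum, Finset.sum_mul, map_sum]
      refine Submodule.sum_mem _ fun φ _ => ?_
      rw [map_smul, mul_smul_comm, smul_mul_assoc, map_smul, Basis.piTensorProduct_apply]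
      exact Submodule.smul_mem _ _ (Submodule.subset_span ⟨(fun i => ⟨α i, hd i⟩, φ, σ), rfl⟩)
    · push Not at hd
      obtain ⟨i, hi⟩ := hd
      obtain ⟨β, rfl⟩ : ∃ β : Fin n → ℕ, α = β + Pi.single i d :=
        ⟨α - Pi.single i d, by
          ext j
          by_cases h : j = i
          · subst h; simp; omega
          · simp [Pi.single_eq_of_ne h]⟩
      set π := Equiv.swap 0 i
      set w := xPow htr b β * ten htr b a * perm htr b σ with hw
      have hπ : perm htr b π * perm htr b π = 1 := by
        rw [← perm_mul, Equiv.swap_mul_self, perm_one]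
      -- Since `π` exchanges `0` and `i` and squares to one, `x_i ^ d w` is the leading term of `π
      -- χ_C π w`, an element of the ideal.
      have e : xPow htr b (β + Pi.single i d) * ten htr b a * perm htr b σ =
          perm htr b π * chi htr b c * (perm htr b π * w) -
            (perm htr b π * chi htr b c - xGen htr b (π 0) ^ d * perm htr b π) *
              (perm htr b π * w) := by
        rw [← sub_mul, sub_sub_cancel, mul_assoc _ _ (_ * w), ← mul_assoc (perm htr b π) _ w, hπ,
          one_mul, Equiv.swap_apply_left, xPow_add_single_nsmul, hw]
        simp only [mul_assoc]
      rw [e, map_sub, map_mul, map_mul, mkₐ_chi, mul_zero, zero_mul, zero_sub]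
      refine neg_mem (ih (degreeFil_mono ?_ (mul_mem_degreeFil (perm_mul_chi_sub_mem c π)
        (perm_mul_mem_degreeFil π (mem_degreeFil a σ (Nat.lt_succ_self _))))))
      simp only [Pi.add_apply, Finset.sum_add_distrib, Finset.sum_pi_single', Finset.mem_univ,
        if_true] at hα
      have : ∑ j, (Pi.single i d : Fin n → ℕ) j = d := by simp
      omega

theorem span_range_cycElt {d : ℕ} (c : Fin d → TensorPow k F n) :
    Submodule.span k (Set.range (cycElt htr b c)) = ⊤ := by
  rw [eq_top_iff]
  rintro z -
  obtain ⟨y, rfl⟩ := RingCon.mkₐ_surjective (α := k) (cycIdeal htr b c).ringCon z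
  obtain ⟨m, hm⟩ := exists_mem_degreeFil y
  exact mkₐ_mem_span_cycElt c m hm

end Spanning

end AffSym

theorem mainTheorem10 {k : Type*} [CommRing k] {F : Type*} [Ring F] [Algebra k F]
    {tr : F →ₗ[k] k} (htr : AffSym.IsSymmetrizing tr)
    {ι : Type*} [Fintype ι] (b : Module.Basis ι k F)
    (n : ℕ) [NeZero n] (d : ℕ) (c : Fin d → AffSym.TensorPow k F n)
    (hc : ∀ j, c j ∈ AffSym.centerPowInvariants k F n) :
    LinearIndependent k (AffSym.cycElt htr b c) ∧
      Submodule.span k (Set.range (AffSym.cycElt htr b c)) = ⊤ :=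
  ⟨AffSym.linearIndependent_cycElt htr b c hc, AffSym.span_range_cycElt c⟩
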